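/- Let $m,n,k\ge 0$ be integers. Write $\varepsilon\in\mathbb R^m$ for a parameter and $x=(q_0,q,p_0,p)\in\mathbb R^{2(n+1)}$, $q=(q_1,\dots,q_n)$, $p=(p_1,\dots,p_n)$, for canonical coordinates. Let $H^\varepsilon(x)$ be a real-valued function that is $C^{k+2}$ in $(\varepsilon,x)$ near $(0,0)$, and suppose that near $(0,0)$ the variable $p_0$ is cyclic ($\partial H^\varepsilon/\partial p_0=0$, so that $q_0$ is conserved by the Hamiltonian system $\dot q_i=\partial H^\varepsilon/\partial p_i$, $\dot p_i=-\partial H^\varepsilon/\partial q_i$, $i=0,\dots,n$) and $$H^\varepsilon(q,p,q_0)=O\big(|(\varepsilon,q_0,q,p)|\,|(q_0,q,p)|\big).$$ Then there is a canonical change of variables $\Phi^\varepsilon:(q,p,q_0,p_0)\mapsto(Q,P,Q_0,P_0)$ near the origin (smooth in $(\varepsilon,x)$, with inverse smooth in $(\varepsilon,X)$, and with symplectic Jacobian matrix) which is near-identity, $\Phi^0(0)=0$ and $\mathrm d\Phi^0[0]=I$, such that $Q_0=q_0$, the variable $P_0$ is cyclic for the transformed Hamiltonian $K^\varepsilon=H^\varepsilon\circ(\Phi^\varepsilon)^{-1}$,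 and the lower-order Hamiltonian $K^\varepsilon(Q,P,0)$, obtained by setting $Q_0=0$, is in Elphick normal form to order $k+1$. That is, with $z=(Q,P)$, $$K^\varepsilon(z,0)=K_2(z)+N(\varepsilon,z)+O(|(\varepsilon,z)|^{k+2}),$$ where $K_2$ is the quadratic part of $K^0(\cdot,0)$ at the origin, $L$ is the matrix of its linear Hamiltonian vector field, and $N$ is a polynomial of degree at most $k+1$ in $(\varepsilon,z)$ with $N(\varepsilon,z)=O(|(\varepsilon,z)|^2)$, $N(0,z)=O(|z|^3)$ and $$\mathrm d_zN(\varepsilon,z)\,[L^{\mathrm T}z]=0\quad\text{for all }\varepsilon,z$$ (equivalently, $N(\varepsilon,\mathrm e^{tL^{\mathrm T}}z)=N(\varepsilon,z)$ for all $t\in\mathbb R$). If moreover $(q,p)=0$ is an equilibrium of the original lower-order system (with $q_0=0$) for all sufficiently small $\varepsilon$, then $\Phi^\varepsilon$ and $N$ also satisfy $\Phi^\varepsilon(x)-x=O(|(\varepsilon,q_0,q,p)|\,|(q,p)|)$, $N(\varepsilon,z)=O(|z|^2|(\varepsilon,z)|)$, and the remainder above is $O(|z|^2|(\varepsilon,z)|^{k})$.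 -/

import Mathlib

open Filter Topology Asymptotics
open scoped Matrix ContDiff

namespace HamNF

/-- Phase space of a system with `n` degrees of freedom: the coordinate `Sum.inl i` is `q_i`,
the coordinate `Sum.inr i` is `p_i`. With `n + 1` degrees of freedom, the index `0` carries the
pair `(q_0, p_0)` and the index `i.succ` carries the remaining pairs. -/
abbrev Phase (n : ℕ) : Type := Fin n ⊕ Fin n → ℝ

/-- Parameters `ε ∈ ℝ^m`. -/
abbrev Param (m : ℕ) : Type := Fin m → ℝ

/-- The partial derivative of `K` with respect to the `j`-th canonical coordinate. -/
noncomputable def partialD {n : ℕ} (K : Phase n → ℝ) (j : Fin n ⊕ Fin n) (x : Phase n) : ℝ :=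
  fderiv ℝ K x (Pi.single j 1)

/-- The Hamiltonian vector field of `K`, that is, the right-hand side of
`q̇_i = ∂K/∂p_i`, `ṗ_i = -∂K/∂q_i`. -/
noncomputable def hamVF {n : ℕ} (K : Phase n → ℝ) (x : Phase n) : Phase n :=
  Sum.elim (fun i => partialD K (Sum.inr i) x) (fun i => -partialD K (Sum.inl i) x)

/-- `p_0` is a cyclic variable of the family `H`: near the origin, `∂H^ε/∂p_0 = 0`. -/
def IsCyclicP0 {m n : ℕ} (H : Param m → Phase (n + 1) → ℝ) : Prop :=
  ∀ᶠ y : Param m × Phase (n + 1) in 𝓝 0, partialD (H y.1) (Sum.inr 0) y.2 = 0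

/-- `(q, p, q_0)`: the variables without `p_0` (which is replaced by zero). -/
def dropP0 {n : ℕ} (x : Phase (n + 1)) : Phase (n + 1) := Function.update x (Sum.inr 0) 0

/-- `(q, p)`: the variables without `q_0` and `p_0`. -/
def restrict {n : ℕ} (x : Phase (n + 1)) : Phase n := fun j => x (Sum.map Fin.succ Fin.succ j)

/-- The point of the full phase space with given `(q, p)` and with `q_0 = p_0 = 0`. -/
def extend {n : ℕ} (z : Phase n) : Phase (n + 1) :=
  Sum.elim (Fin.cons 0 fun i => z (Sum.inl i)) (Fin.cons 0 fun i => z (Sum.inr i))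

/-- The Hamiltonian of the lower-order system: `q_0` is set to zero. (If `p_0` is cyclic, its
value is irrelevant; it is set to zero as well.) -/
def lowerOrder {m n : ℕ} (H : Param m → Phase (n + 1) → ℝ) : Param m → Phase n → ℝ :=
  fun ε z => H ε (extend z)

/-- `Φ^ε` is a parameter-dependent canonical change of variables near the origin with inverse
`Ψ^ε`: both are smooth in `(ε, x)`, they are mutually inverse, and the Jacobian matrix of `Φ^ε`
is symplectic. -/
structure IsCanonicalChange {m N : ℕ} (Φ Ψ : Param m → Phase N → Phase N) : Prop where
  smooth : ∀ᶠ y : Param m × Phase N in 𝓝 0, ContDiffAt ℝ ∞ (Function.uncurry Φ) y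
  smooth_inv : ∀ᶠ y : Param m × Phase N in 𝓝 0, ContDiffAt ℝ ∞ (Function.uncurry Ψ) y
  left_inv : ∀ᶠ y : Param m × Phase N in 𝓝 0, Ψ y.1 (Φ y.1 y.2) = y.2
  right_inv : ∀ᶠ y : Param m × Phase N in 𝓝 0, Φ y.1 (Ψ y.1 y.2) = y.2
  symplectic : ∀ᶠ y : Param m × Phase N in 𝓝 0,
    LinearMap.toMatrix' (fderiv ℝ (Φ y.1) y.2 : Phase N →ₗ[ℝ] Phase N) ∈
      Matrix.symplecticGroup (Fin N) ℝ

/-- At `ε = 0` the change of variables fixes the origin and has derivative the identity there. -/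
def IsNearIdentity {m N : ℕ} (Φ : Param m → Phase N → Phase N) : Prop :=
  Φ 0 0 = 0 ∧ fderiv ℝ (Φ 0) 0 = ContinuousLinearMap.id ℝ (Phase N)

/-- The quadratic part at the origin of a Hamiltonian. -/
noncomputable def quadraticPart {n : ℕ} (K : Phase n → ℝ) (z : Phase n) : ℝ :=
  (1 / 2) * fderiv ℝ (fderiv ℝ K) 0 z z

/-- The matrix of the linearisation at the origin of the Hamiltonian vector field of `K`. -/
noncomputable def linearisation {n : ℕ} (K : Phase n → ℝ) :
    Matrix (Fin n ⊕ Fin n) (Fin n ⊕ Fin n) ℝ :=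
  LinearMap.toMatrix' (fderiv ℝ (hamVF K) 0 : Phase n →ₗ[ℝ] Phase n)

/-- The value at `(ε, z)` of a polynomial in the parameters and the phase-space variables. -/
noncomputable def evalAt {m n : ℕ} (P : MvPolynomial (Fin m ⊕ (Fin n ⊕ Fin n)) ℝ)
    (ε : Param m) (z : Phase n) : ℝ :=
  MvPolynomial.eval (Sum.elim ε z) P

/-- Elphick's condition: the derivative of `P(ε, ·)` along the linear vector field `z ↦ Lᵀ z`
vanishes identically, that is, `P(ε, ·)` is invariant under `exp (t Lᵀ)`. -/
def ElphickInvariant {m n : ℕ} (L : Matrix (Fin n ⊕ Fin n) (Fin n ⊕ Fin n) ℝ)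
    (P : MvPolynomial (Fin m ⊕ (Fin n ⊕ Fin n)) ℝ) : Prop :=
  ∀ (ε : Param m) (z : Phase n), fderiv ℝ (evalAt P ε) z (Lᵀ *ᵥ z) = 0

/-- The family `K` is in Elphick normal form to order `k + 1`:
`K^ε(z) = K₂(z) + P(ε, z) + O(|(ε, z)|^(k + 2))`, where `K₂` is the quadratic part at `ε = 0` and
`P` is a polynomial of degree at most `k + 1`, invariant under `exp (t Lᵀ)` with `L` the linear
part at `ε = 0`, with `P(ε, z) = O(|(ε, z)|²)` and `P(0, z) = O(|z|³)`. -/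
def InNormalForm {m n : ℕ} (k : ℕ) (K : Param m → Phase n → ℝ)
    (P : MvPolynomial (Fin m ⊕ (Fin n ⊕ Fin n)) ℝ) : Prop :=
  P.totalDegree ≤ k + 1 ∧
  ElphickInvariant (linearisation (K 0)) P ∧
  (fun y : Param m × Phase n => evalAt P y.1 y.2) =O[𝓝 0] (fun y => ‖y‖ ^ 2) ∧
  (fun z : Phase n => evalAt P 0 z) =O[𝓝 0] (fun z => ‖z‖ ^ 3) ∧
  (fun y : Param m × Phase n => K y.1 y.2 - quadraticPart (K 0) y.2 - evalAt P y.1 y.2)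
    =O[𝓝 0] (fun y => ‖y‖ ^ (k + 2))

end HamNF

/-! Grade polynomials in (ε, z) by weight, each parameter counting 2 and each phase variable 1. The
lower-order Hamiltonian vanishes at z = 0 and to second order at the origin, so its Taylor
polynomial has total degree at least 2 and z-degree at least 1 in every monomial. Such a monomial
has weight below 3 only if it is quadratic in z alone (`exists_quadForm`). Hence the Hamiltonian is
a quadratic form plus terms of weight at least 3, and even ε_i z_j is a perturbation.

Normalisation proceeds weight by weight. A canonical change generated by S of weight w ≥ 3 leaves
lower weights alone and changes the part F of weight w into F minus the derivative of S along Lz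
(`shearHom_quadForm`). For the Fischer inner product the adjoint of the derivative along Lz is the
derivative along Lᵀz (`fischer_linVF`), so projecting F orthogonally to the image leaves a term
annihilated by the latter (`exists_homological`).

No differential equation is solved to produce the changes. Generators of weight w are taken from the
span of the ε^a⟨v, z⟩^b, and each of these has an explicit flow: a global polynomial symplectic
shear. Composing shears adds generators to leading order (`exists_polyChange_of_mem_span`). With v
extended by zero to the full phase space, the shears ignore q_0 and p_0, which preserves both q_0
and cyclicity.

The index r is 1 in general and 2 in the equilibrium case. It bounds the z-degree of generators from
below, and for r = 2 the Hamiltonian is treated modulo |z|² throughout. The Taylor remainder of a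
merely C^(k+2) Hamiltonian must show the matching factor |z|^r; `exists_phaseTaylor` obtains it by
integrating approximations of derivatives in the z directions only. -/

namespace HamNF

open MvPolynomial

/-! ### Weight filtrations and substitutions that raise weights. -/

section Filtration

variable {τ : Type*}

/-- Polynomials all of whose monomials have weight at least `r`. -/
noncomputable def filtration (wt : τ → ℕ) (r : ℕ) : Submodule ℝ (MvPolynomial τ ℝ) :=
  restrictSupport ℝ {s | r ≤ Finsupp.weight wt s}

theorem filtration_anti {wt : τ → ℕ} {r t : ℕ} (h : r ≤ t) {p : MvPolynomial τ ℝ}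
    (hp : p ∈ filtration wt t) : p ∈ filtration wt r :=
  fun _ hs => h.trans (hp hs)

theorem mem_filtration_zero (wt : τ → ℕ) (p : MvPolynomial τ ℝ) : p ∈ filtration wt 0 :=
  fun _ _ => Nat.zero_le _

theorem mul_mem_filtration {wt : τ → ℕ} {r t : ℕ} {p q : MvPolynomial τ ℝ}
    (hp : p ∈ filtration wt r) (hq : q ∈ filtration wt t) : p * q ∈ filtration wt (r + t) := by
  classical
  intro s hs
  obtain ⟨a, ha, b, hb, rfl⟩ := Finset.mem_add.1 (support_mul p q hs)
  simpa using add_le_add (hp ha) (hq hb)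

theorem C_mul_mem_filtration {wt : τ → ℕ} {r : ℕ} {p : MvPolynomial τ ℝ} (c : ℝ)
    (hp : p ∈ filtration wt r) : C c * p ∈ filtration wt r := by
  rw [C_mul']
  exact Submodule.smul_mem _ _ hp

theorem pow_mem_filtration {wt : τ → ℕ} {r : ℕ} {p : MvPolynomial τ ℝ}
    (hp : p ∈ filtration wt r) (b : ℕ) : p ^ b ∈ filtration wt (b * r) := by
  induction b with
  | zero => simpa using mem_filtration_zero wt _
  | succ b ih =>
    rw [pow_succ, add_mul, one_mul]
    exact mul_mem_filtration ih hp

theorem monomial_mem_filtration (wt : τ → ℕ) (s : τ →₀ ℕ) (c : ℝ) :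
    monomial s c ∈ filtration wt (Finsupp.weight wt s) :=
  (monomial_mem_restrictSupport ℝ).2 (Or.inl (le_refl (Finsupp.weight wt s)))

theorem X_mem_filtration (wt : τ → ℕ) (i : τ) : (X i : MvPolynomial τ ℝ) ∈ filtration wt (wt i) := by
  have h := monomial_mem_filtration wt (Finsupp.single i 1) 1
  rwa [Finsupp.weight_single, one_smul] at h

/-- An algebra endomorphism of the polynomial ring whose deviation from the identity raises
weights by at least `d`. -/
def Raises (wt : τ → ℕ) (d : ℕ) (θ : MvPolynomial τ ℝ →ₐ[ℝ] MvPolynomial τ ℝ) : Prop :=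
  ∀ i, θ (X i) - X i ∈ filtration wt (wt i + d)

/-- Writing δ = θ − id, one has δ(fg) = δf δg + δf g + f δg, so a gain of d on the variables passes
to monomials by induction and then to sums. -/
theorem Raises.sub_mem {wt : τ → ℕ} {d : ℕ} {θ : MvPolynomial τ ℝ →ₐ[ℝ] MvPolynomial τ ℝ}
    (hθ : Raises wt d θ) {r : ℕ} {p : MvPolynomial τ ℝ} (hp : p ∈ filtration wt r) :
    θ p - p ∈ filtration wt (r + d) := by
  have hmon : ∀ (s : τ →₀ ℕ) (c : ℝ),
      θ (monomial s c) - monomial s c ∈ filtration wt (Finsupp.weight wt s + d) := by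
    intro s
    induction s using Finsupp.induction_linear with
    | zero =>
      intro c
      have : θ (monomial 0 c) = monomial 0 c := θ.commutes c
      rw [this, sub_self]
      exact Submodule.zero_mem _
    | add f g hf hg =>
      intro c
      have e : monomial (f + g) c = monomial f c * monomial g (1 : ℝ) := by
        rw [monomial_mul, mul_one]
      have key : θ (monomial (f + g) c) - monomial (f + g) c =
          (θ (monomial f c) - monomial f c) * (θ (monomial g 1) - monomial g 1)
          + (θ (monomial f c) - monomial f c) * monomial g 1
          + monomial f c * (θ (monomial g 1) - monomial g 1) := by
        rw [e, map_mul]; ring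
      rw [key, map_add]
      refine Submodule.add_mem _ (Submodule.add_mem _ ?_ ?_) ?_
      · exact filtration_anti (by omega) (mul_mem_filtration (hf c) (hg 1))
      · exact filtration_anti (by omega)
          (mul_mem_filtration (hf c) (monomial_mem_filtration wt g 1))
      · exact filtration_anti (by omega)
          (mul_mem_filtration (monomial_mem_filtration wt f c) (hg 1))
    | single i b =>
      intro c
      have e : ∀ b : ℕ, θ ((X i : MvPolynomial τ ℝ) ^ b) - X i ^ b
          ∈ filtration wt (b * wt i + d) := by
        intro b
        induction b with
        | zero => simp
        | succ b ih =>
          have key : θ ((X i : MvPolynomial τ ℝ) ^ (b + 1)) - X i ^ (b + 1) =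
            (θ (X i ^ b) - X i ^ b) * (θ (X i) - X i) + (θ (X i ^ b) - X i ^ b) * X i
              + X i ^ b * (θ (X i) - X i) := by
            rw [pow_succ, map_mul]; ring
          rw [key, add_mul, one_mul]
          refine Submodule.add_mem _ (Submodule.add_mem _ ?_ ?_) ?_
          · exact filtration_anti (by omega) (mul_mem_filtration ih (hθ i))
          · exact filtration_anti (by omega) (mul_mem_filtration ih (X_mem_filtration wt i))
          · exact filtration_anti (by omega)
              (mul_mem_filtration (pow_mem_filtration (X_mem_filtration wt i) b) (hθ i))
      have h1 : monomial (Finsupp.single i b) c = C c * (X i : MvPolynomial τ ℝ) ^ b := by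
        rw [C_mul_X_pow_eq_monomial]
      have h2 : θ (C c) = C c := θ.commutes c
      rw [h1, map_mul, h2, ← mul_sub, Finsupp.weight_single]
      exact C_mul_mem_filtration c (by simpa using e b)
  rw [p.as_sum, map_sum, ← Finset.sum_sub_distrib]
  exact Submodule.sum_mem _ fun s hs =>
    filtration_anti (Nat.add_le_add_right (hp hs) d) (hmon s _)

theorem Raises.map_mem {wt : τ → ℕ} {d : ℕ} {θ : MvPolynomial τ ℝ →ₐ[ℝ] MvPolynomial τ ℝ}
    (hθ : Raises wt d θ) {r : ℕ} {p : MvPolynomial τ ℝ} (hp : p ∈ filtration wt r) :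
    θ p ∈ filtration wt r := by
  have := Submodule.add_mem _ (filtration_anti (Nat.le_add_right r d) (hθ.sub_mem hp)) hp
  simpa using this

theorem Raises.id (wt : τ → ℕ) (d : ℕ) : Raises wt d (AlgHom.id ℝ _) := fun i => by simp

theorem Raises.comp {wt : τ → ℕ} {d : ℕ} {θ₁ θ₂ : MvPolynomial τ ℝ →ₐ[ℝ] MvPolynomial τ ℝ}
    (h₁ : Raises wt d θ₁) (h₂ : Raises wt d θ₂) : Raises wt d (θ₁.comp θ₂) := fun i => by
  have : (θ₁.comp θ₂) (X i) - X i = θ₁ (θ₂ (X i) - X i) + (θ₁ (X i) - X i) := by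
    simp
  rw [this]
  exact Submodule.add_mem _ (h₁.map_mem (h₂ i)) (h₁ i)

end Filtration

/-! ### The Fischer inner product and orthogonal projection. -/

section Fischer

variable {τ : Type*} [Fintype τ]

/-- The Fischer inner product, for which monomials are orthogonal and `⟨y^s, y^s⟩ = s!`. -/
noncomputable def fischer :
    MvPolynomial τ ℝ →ₗ[ℝ] MvPolynomial τ ℝ →ₗ[ℝ] ℝ :=
  (basisMonomials τ ℝ).constr ℝ fun s => ((∏ i, (s i).factorial : ℕ) : ℝ) • lcoeff ℝ s

theorem fischer_monomial (s : τ →₀ ℕ) (c : ℝ) (Q : MvPolynomial τ ℝ) :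
    fischer (monomial s c) Q = c * ((∏ i, (s i).factorial : ℕ) : ℝ) * coeff s Q := by
  have h : monomial s c = c • basisMonomials τ ℝ s := by
    simp [smul_monomial]
  rw [h, map_smul, fischer, Module.Basis.constr_basis]
  simp [mul_assoc]

theorem fischer_eq_sum (P Q : MvPolynomial τ ℝ) :
    fischer P Q = ∑ s ∈ P.support, coeff s P * ((∏ i, (s i).factorial : ℕ) : ℝ) * coeff s Q := by
  conv_lhs => rw [P.as_sum]
  rw [map_sum, LinearMap.sum_apply]
  simp_rw [fischer_monomial]

theorem fischer_comm (P Q : MvPolynomial τ ℝ) : fischer P Q = fischer Q P := by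
  classical
  have h : ∀ P Q : MvPolynomial τ ℝ, fischer P Q =
      ∑ s ∈ P.support ∪ Q.support,
        coeff s P * ((∏ i, (s i).factorial : ℕ) : ℝ) * coeff s Q := fun P Q => by
    rw [fischer_eq_sum]
    refine Finset.sum_subset Finset.subset_union_left fun s _ hs => ?_
    simp [notMem_support_iff.1 hs]
  rw [h P Q, h Q P, Finset.union_comm]
  exact Finset.sum_congr rfl fun s _ => by ring

theorem fischer_self_pos {P : MvPolynomial τ ℝ} (hP : P ≠ 0) : 0 < fischer P P := by
  rw [fischer_eq_sum]
  refine Finset.sum_pos (fun s hs => ?_) (support_nonempty.2 hP)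
  have h1 : (0 : ℝ) < ((∏ i, (s i).factorial : ℕ) : ℝ) :=
    Nat.cast_pos.2 (Finset.prod_pos fun i _ => Nat.factorial_pos _)
  have h2 : coeff s P ≠ 0 := mem_support_iff.1 hs
  have h3 : 0 < coeff s P * coeff s P := mul_self_pos.2 h2
  calc 0 < (coeff s P * coeff s P) * ((∏ i, (s i).factorial : ℕ) : ℝ) := mul_pos h3 h1
    _ = _ := by ring

/-- The factorials in the inner product serve this adjunction: (s_i + 1)! = (s_i + 1) s_i! absorbs
the factor that differentiation produces. -/
theorem fischer_X_mul (i : τ) (P Q : MvPolynomial τ ℝ) :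
    fischer (X i * P) Q = fischer P (pderiv i Q) := by
  classical
  induction P using MvPolynomial.induction_on' with
  | add p q hp hq => simp only [mul_add, map_add, LinearMap.add_apply, hp, hq]
  | monomial s c =>
    have e : X i * monomial s c = monomial (Finsupp.single i 1 + s) c := by
      rw [X, monomial_mul, one_mul]
    rw [e, fischer_monomial, fischer_monomial, coeff_pderiv, add_comm (Finsupp.single i 1) s]
    have hf : (∏ j, ((s + Finsupp.single i 1 : τ →₀ ℕ) j).factorial) =
        (s i + 1) * ∏ j, (s j).factorial := by
      rw [← Finset.mul_prod_erase _ _ (Finset.mem_univ i),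
        ← Finset.mul_prod_erase _ (fun j => (s j).factorial) (Finset.mem_univ i), ← mul_assoc]
      congr 1
      · simp [Nat.factorial_succ]
      · refine Finset.prod_congr rfl fun j hj => ?_
        have : i ≠ j := (Finset.ne_of_mem_erase hj).symm
        simp [this]
    rw [hf]
    push_cast
    ring

/-- For a positive definite symmetric form, a vector can be projected orthogonally onto the image
of a finite-dimensional subspace. -/
theorem exists_sub_orthogonal {V : Type*} [AddCommGroup V] [Module ℝ V]
    (B : V →ₗ[ℝ] V →ₗ[ℝ] ℝ) (hB : ∀ x, x ≠ 0 → 0 < B x x) (A : V →ₗ[ℝ] V)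
    (W : Submodule ℝ V) [FiniteDimensional ℝ W] (F : V) :
    ∃ S ∈ W, ∀ S' ∈ W, B (F - A S) (A S') = 0 := by
  -- The functional given by F is represented inside the finite-dimensional image of W: positive
  -- definiteness embeds the image in its dual, and equality of dimensions makes this embedding
  -- surjective.
  let M := W.map A
  let φ : M →ₗ[ℝ] Module.Dual ℝ M := (B.domRestrict₁₂ M M)
  have hinj : Function.Injective φ := by
    rw [injective_iff_map_eq_zero]
    intro x hx
    by_contra hne
    have h1 : B x x = 0 := LinearMap.congr_fun hx x
    exact absurd h1 (hB x (fun h => hne (Subtype.ext h))).ne'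
  have hsurj : Function.Surjective φ :=
    (LinearMap.injective_iff_surjective_of_finrank_eq_finrank
      (Subspace.dual_finrank_eq (K := ℝ) (V := M)).symm).1 hinj
  obtain ⟨x, hx⟩ := hsurj ((B F).domRestrict M)
  obtain ⟨S, hS, hSx⟩ := x.2
  refine ⟨S, hS, fun S' hS' => ?_⟩
  have := LinearMap.congr_fun hx ⟨A S', Submodule.mem_map_of_mem hS'⟩
  have h2 : B x.1 (A S') = B F (A S') := this
  have h3 : A S = x.1 := hSx
  rw [map_sub, LinearMap.sub_apply, h3, h2, sub_self]

end Fischer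

/-! ### The homological equation in the weighted grading. -/

section Homological

variable {σ κ : Type*}

/-- The weight giving `2` to the parameters and `1` to the phase-space variables. -/
def parWeight : σ ⊕ κ → ℕ := Sum.elim (fun _ => 2) (fun _ => 1)

/-- The weight counting the degree in the phase-space variables. -/
def phaseWeight : σ ⊕ κ → ℕ := Sum.elim (fun _ => 0) (fun _ => 1)

variable [Fintype σ] [Fintype κ]

/-- The exponent of the monomial `ε^a z^b`. -/
noncomputable def expo (a : σ → ℕ) (b : κ → ℕ) : σ ⊕ κ →₀ ℕ :=
  Finsupp.equivFunOnFinite.symm (Sum.elim a b)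

@[simp] theorem expo_inl (a : σ → ℕ) (b : κ → ℕ) (i : σ) : expo a b (Sum.inl i) = a i := rfl

@[simp] theorem expo_inr (a : σ → ℕ) (b : κ → ℕ) (j : κ) : expo a b (Sum.inr j) = b j := rfl

theorem expo_self (s : σ ⊕ κ →₀ ℕ) :
    expo (fun i => s (Sum.inl i)) (fun j => s (Sum.inr j)) = s := by
  ext (i | j) <;> rfl

theorem parWeight_eq (s : σ ⊕ κ →₀ ℕ) :
    Finsupp.weight parWeight s = 2 * ∑ i, s (Sum.inl i) + ∑ j, s (Sum.inr j) := by
  rw [Finsupp.weight_eq_sum, Fintype.sum_sum_type]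
  simp [parWeight, Finset.mul_sum, mul_comm]

theorem phaseWeight_eq (s : σ ⊕ κ →₀ ℕ) :
    Finsupp.weight phaseWeight s = ∑ j, s (Sum.inr j) := by
  rw [Finsupp.weight_eq_sum, Fintype.sum_sum_type]
  simp [phaseWeight]

theorem oneWeight_eq (s : σ ⊕ κ →₀ ℕ) :
    Finsupp.weight (fun _ => 1 : σ ⊕ κ → ℕ) s = ∑ i, s (Sum.inl i) + ∑ j, s (Sum.inr j) := by
  rw [Finsupp.weight_eq_sum, Fintype.sum_sum_type]
  simp

theorem monomial_expo (a : σ → ℕ) (b : κ → ℕ) (c : ℝ) :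
    monomial (expo a b) c = C c * ((∏ i, X (Sum.inl i) ^ a i) * ∏ j, X (Sum.inr j) ^ b j) := by
  rw [monomial_eq, Finsupp.prod_fintype _ _ (fun i => pow_zero _), Fintype.prod_sum_type]
  simp

/-- The linear form `⟨v, z⟩` as a polynomial. -/
noncomputable def linForm (v : κ → ℝ) : MvPolynomial (σ ⊕ κ) ℝ :=
  ∑ j, C (v j) * X (Sum.inr j)

/-- The polynomial `ε^a ⟨v, z⟩^b`. -/
noncomputable def powGen (a : σ → ℕ) (v : κ → ℝ) (b : ℕ) : MvPolynomial (σ ⊕ κ) ℝ :=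
  (∏ i, X (Sum.inl i) ^ a i) * linForm v ^ b

/-- The polynomials `ε^a ⟨v, z⟩^b` of weight `w` with `b ≥ r`. -/
def powGenSet (w r : ℕ) : Set (MvPolynomial (σ ⊕ κ) ℝ) :=
  {S | ∃ (a : σ → ℕ) (v : κ → ℝ) (b : ℕ), r ≤ b ∧ 2 * ∑ i, a i + b = w ∧ S = powGen a v b}

variable [DecidableEq κ]

theorem powGen_eq_sum (a : σ → ℕ) (v : κ → ℝ) (b : ℕ) :
    powGen a v b = ∑ k ∈ Finset.piAntidiag Finset.univ b,
      monomial (expo a k) ((Nat.multinomial Finset.univ k : ℝ) * ∏ j, v j ^ k j) := by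
  rw [powGen, linForm, Finset.sum_pow_eq_sum_piAntidiag, Finset.mul_sum]
  refine Finset.sum_congr rfl fun k _ => ?_
  rw [monomial_expo]
  simp_rw [mul_pow, Finset.prod_mul_distrib]
  simp only [map_mul, map_prod, map_pow, map_natCast]
  ring

/-- Each multinomial coefficient times k! equals b!, so pairing with ε^a⟨v, z⟩^b amounts, up to a
positive constant, to evaluating at v the degree-b part of the coefficient of ε^a in G. -/
theorem fischer_powGen (a : σ → ℕ) (v : κ → ℝ) (b : ℕ) (G : MvPolynomial (σ ⊕ κ) ℝ) :
    fischer (powGen a v b) G = ((∏ i, (a i).factorial : ℕ) : ℝ) * (b.factorial : ℝ) *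
      ∑ k ∈ Finset.piAntidiag Finset.univ b, (∏ j, v j ^ k j) * coeff (expo a k) G := by
  rw [powGen_eq_sum, map_sum, LinearMap.sum_apply, Finset.mul_sum]
  refine Finset.sum_congr rfl fun k hk => ?_
  rw [fischer_monomial, Fintype.prod_sum_type]
  have h := Nat.multinomial_spec Finset.univ k
  rw [(Finset.mem_piAntidiag.1 hk).1] at h
  rw [← h]
  simp only [expo_inl, expo_inr]
  push_cast
  ring

/-- A polynomial orthogonal to all `ε^a ⟨v, z⟩^b` of weight `w` with `b ≥ r` vanishes if all its
monomials are of this weight and of degree at least `r` in `z`. -/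
theorem eq_zero_of_fischer_powGen {w r : ℕ} {G : MvPolynomial (σ ⊕ κ) ℝ}
    (hw : IsWeightedHomogeneous parWeight G w) (hr : G ∈ filtration phaseWeight r)
    (h : ∀ S ∈ powGenSet w r, fischer S G = 0) : G = 0 := by
  classical
  ext s
  rw [coeff_zero]
  by_contra hs
  set a : σ → ℕ := fun i => s (Sum.inl i) with ha
  set k₀ : κ → ℕ := fun j => s (Sum.inr j) with hk₀
  set b := ∑ j, k₀ j with hb
  have hrb : r ≤ b := by
    have := hr (mem_support_iff.2 hs)
    rwa [Set.mem_ofPred_eq, phaseWeight_eq] at this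
  have hwb : 2 * ∑ i, a i + b = w := by
    rw [← hw hs, parWeight_eq]
  -- `g` is the degree-b part in z of the coefficient of ε^a in G. Orthogonality says that it
  -- vanishes at every v, hence identically.
  let g : MvPolynomial κ ℝ := ∑ k ∈ Finset.piAntidiag Finset.univ b,
    monomial (Finsupp.equivFunOnFinite.symm k) (coeff (expo a k) G)
  have hg : g = 0 := by
    apply MvPolynomial.funext
    intro v
    have h1 := h (powGen a v b) ⟨a, v, b, hrb, hwb, rfl⟩
    rw [fischer_powGen] at h1
    have h2 : ((∏ i, (a i).factorial : ℕ) : ℝ) * (b.factorial : ℝ) ≠ 0 := by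
      refine mul_ne_zero (Nat.cast_ne_zero.2 ?_) (Nat.cast_ne_zero.2 (Nat.factorial_ne_zero _))
      exact Finset.prod_ne_zero_iff.2 fun i _ => Nat.factorial_ne_zero _
    have h3 := (mul_eq_zero.1 h1).resolve_left h2
    rw [map_zero, ← h3]
    simp only [g, map_sum]
    refine Finset.sum_congr rfl fun k _ => ?_
    rw [eval_monomial, Finsupp.prod_fintype _ _ (fun i => pow_zero _), mul_comm]
    simp
  have h4 : coeff (Finsupp.equivFunOnFinite.symm k₀) g = coeff s G := by
    simp only [g, coeff_sum, coeff_monomial]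
    rw [Finset.sum_eq_single k₀]
    · rw [if_pos rfl, expo_self]
    · intro k _ hk
      rw [if_neg]
      simpa using hk
    · intro hk
      exact absurd (Finset.mem_piAntidiag.2 ⟨hb.symm, fun i _ => Finset.mem_univ i⟩) hk
  rw [hg, coeff_zero] at h4
  exact hs h4.symm

/-- The derivative along the linear vector field `z ↦ L z`. -/
noncomputable def linVF (L : Matrix κ κ ℝ) :
    MvPolynomial (σ ⊕ κ) ℝ →ₗ[ℝ] MvPolynomial (σ ⊕ κ) ℝ :=
  ∑ i, ∑ j, L i j • (LinearMap.mulLeft ℝ (X (Sum.inr j)) ∘ₗ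
    (pderiv (R := ℝ) (Sum.inr i : σ ⊕ κ)).toLinearMap)

omit [Fintype σ] [DecidableEq κ] in
theorem linVF_apply (L : Matrix κ κ ℝ) (P : MvPolynomial (σ ⊕ κ) ℝ) :
    linVF L P = ∑ i, ∑ j, L i j • (X (Sum.inr j) * pderiv (Sum.inr i) P) := by
  simp [linVF, LinearMap.sum_apply]

-- Since multiplication by z_j and ∂/∂z_j are adjoint, so are z_j ∂/∂z_i and z_i ∂/∂z_j. This is the
-- origin of the transpose in Elphick's condition.
omit [DecidableEq κ] in
theorem fischer_linVF (L : Matrix κ κ ℝ) (P Q : MvPolynomial (σ ⊕ κ) ℝ) :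
    fischer (linVF L P) Q = fischer P (linVF Lᵀ Q) := by
  simp only [linVF_apply, map_sum, LinearMap.sum_apply, map_smul, LinearMap.smul_apply,
    fischer_X_mul]
  rw [Finset.sum_comm]
  refine Finset.sum_congr rfl fun i _ => Finset.sum_congr rfl fun j _ => ?_
  rw [fischer_comm P, fischer_X_mul, fischer_comm, Matrix.transpose_apply]

omit [Fintype σ] [DecidableEq κ] in
/-- Any property of exponents invariant under trading one phase-space variable for another is
inherited by the derivative along a linear vector field. -/
theorem linVF_mem_restrictSupport (L : Matrix κ κ ℝ) {A : Set (σ ⊕ κ →₀ ℕ)}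
    (hA : ∀ (s : σ ⊕ κ →₀ ℕ) (i j : κ), s + Finsupp.single (Sum.inr i) 1 ∈ A →
      s + Finsupp.single (Sum.inr j) 1 ∈ A)
    {P : MvPolynomial (σ ⊕ κ) ℝ} (hP : P ∈ restrictSupport ℝ A) :
    linVF L P ∈ restrictSupport ℝ A := by
  classical
  rw [linVF_apply]
  refine Submodule.sum_mem _ fun i _ => Submodule.sum_mem _ fun j _ => Submodule.smul_mem _ _ ?_
  intro s hs
  have hs' : coeff s (X (Sum.inr j) * pderiv (Sum.inr i) P) ≠ 0 := mem_support_iff.1 hs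
  rw [coeff_X_mul'] at hs'
  split_ifs at hs' with hj
  · rw [coeff_pderiv] at hs'
    have h1 := hP (mem_support_iff.2 (left_ne_zero_of_mul hs'))
    have h2 := hA _ i j h1
    rwa [tsub_add_cancel_of_le] at h2
    rw [Finsupp.single_le_iff]
    exact Nat.one_le_iff_ne_zero.2 (Finsupp.mem_support_iff.1 hj)
  · exact absurd rfl hs'

omit [DecidableEq κ] in
theorem powGen_homogeneous (a : σ → ℕ) (v : κ → ℝ) (b : ℕ) :
    IsWeightedHomogeneous parWeight (powGen a v b) (2 * ∑ i, a i + b) ∧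
      powGen a v b ∈ filtration phaseWeight b := by
  classical
  rw [powGen_eq_sum]
  constructor
  · refine (weightedHomogeneousSubmodule ℝ parWeight _).sum_mem fun k hk =>
      isWeightedHomogeneous_monomial _ _ _ ?_
    rw [parWeight_eq]
    simp only [expo_inl, expo_inr, (Finset.mem_piAntidiag.1 hk).1]
  · refine Submodule.sum_mem _ fun k hk => ?_
    have := monomial_mem_filtration phaseWeight (expo a k)
      ((Nat.multinomial Finset.univ k : ℝ) * ∏ j, v j ^ k j)
    rw [phaseWeight_eq] at this
    simpa only [expo_inr, (Finset.mem_piAntidiag.1 hk).1] using this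

omit [Fintype σ] [DecidableEq κ] in
theorem linVF_homogeneous (L : Matrix κ κ ℝ) {w : ℕ} {P : MvPolynomial (σ ⊕ κ) ℝ}
    (hP : IsWeightedHomogeneous parWeight P w) : IsWeightedHomogeneous parWeight (linVF L P) w := by
  intro s hs
  refine linVF_mem_restrictSupport L (A := {s | Finsupp.weight parWeight s = w}) ?_ ?_
    (mem_support_iff.2 hs)
  · intro s i j h
    simp only [Set.mem_ofPred_eq] at h ⊢
    rw [← h]
    simp [Finsupp.weight_single, parWeight]
  · exact fun s hs => hP (mem_support_iff.1 hs)

omit [Fintype σ] [DecidableEq κ] in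
theorem linVF_mem_phase (L : Matrix κ κ ℝ) {r : ℕ} {P : MvPolynomial (σ ⊕ κ) ℝ}
    (hP : P ∈ filtration phaseWeight r) : linVF L P ∈ filtration phaseWeight r := by
  refine linVF_mem_restrictSupport L ?_ hP
  intro s i j h
  simp only [Set.mem_ofPred_eq] at h ⊢
  refine h.trans_eq ?_
  simp [Finsupp.weight_single, phaseWeight]

-- For r = 1 this spares the homological equation any hypothesis on F: pure parameter terms, which
-- ε-dependent translations may create, are annihilated by the derivative and can stay in the normal
-- form.
omit [Fintype σ] [DecidableEq κ] in
theorem linVF_mem_phase_one (L : Matrix κ κ ℝ) (P : MvPolynomial (σ ⊕ κ) ℝ) :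
    linVF L P ∈ filtration phaseWeight 1 := by
  rw [linVF_apply]
  refine Submodule.sum_mem _ fun i _ => Submodule.sum_mem _ fun j _ => Submodule.smul_mem _ _ ?_
  exact mul_mem_filtration (X_mem_filtration phaseWeight (Sum.inr j)) (mem_filtration_zero _ _)

omit [DecidableEq κ] in
theorem span_powGenSet_le (w r : ℕ) :
    Submodule.span ℝ (powGenSet (σ := σ) (κ := κ) w r) ≤
      restrictSupport ℝ {s | Finsupp.weight parWeight s = w} ⊓ filtration phaseWeight r := by
  refine Submodule.span_le.2 ?_
  rintro _ ⟨a, v, b, hrb, rfl, rfl⟩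
  exact ⟨fun s hs => (powGen_homogeneous a v b).1 (mem_support_iff.1 hs),
    filtration_anti hrb (powGen_homogeneous a v b).2⟩

/-- Solution of the homological equation: modulo the image of the derivative along `L z`, a
polynomial of weight `w` is invariant along `Lᵀ z`. -/
theorem exists_homological (L : Matrix κ κ ℝ) (w r : ℕ) (F : MvPolynomial (σ ⊕ κ) ℝ)
    (hF : IsWeightedHomogeneous parWeight F w) (hr : r = 1 ∨ F ∈ filtration phaseWeight r) :
    ∃ S ∈ Submodule.span ℝ (powGenSet w r), linVF Lᵀ (F - linVF L S) = 0 := by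
  have hfin : {s : σ ⊕ κ →₀ ℕ | Finsupp.weight parWeight s = w}.Finite := by
    refine Finsupp.finite_of_nat_weight_eq _ ?_ w
    rintro (i | j) <;> simp [parWeight]
  have : Finite {s : σ ⊕ κ →₀ ℕ | Finsupp.weight parWeight s = w} := hfin
  have : FiniteDimensional ℝ
      (restrictSupport ℝ {s : σ ⊕ κ →₀ ℕ | Finsupp.weight parWeight s = w}) :=
    Module.Finite.of_basis (basisRestrictSupport ℝ _)
  have : FiniteDimensional ℝ (Submodule.span ℝ (powGenSet (σ := σ) (κ := κ) w r)) :=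
    Submodule.finiteDimensional_of_le ((span_powGenSet_le w r).trans inf_le_left)
  obtain ⟨S, hS, h⟩ := exists_sub_orthogonal fischer (fun _ h => fischer_self_pos h) (linVF L)
    (Submodule.span ℝ (powGenSet w r)) F
  refine ⟨S, hS, ?_⟩
  have hS' := span_powGenSet_le w r hS
  have hSw : IsWeightedHomogeneous parWeight S w := fun s hs => hS'.1 (mem_support_iff.2 hs)
  -- By adjunction, orthogonality of F − LS to the image of the generators means that its derivative
  -- along Lᵀz is orthogonal to the generators themselves, and these detect every polynomial of this
  -- weight and z-degree.
  refine eq_zero_of_fischer_powGen (w := w) (r := r) ?_ ?_ ?_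
  · exact linVF_homogeneous _ ((weightedHomogeneousSubmodule ℝ parWeight w).sub_mem hF
      (linVF_homogeneous L hSw))
  · rcases hr with rfl | hr
    · exact linVF_mem_phase_one _ _
    · exact linVF_mem_phase _ (Submodule.sub_mem _ hr (linVF_mem_phase L hS'.2))
  · intro S' hS'
    rw [← fischer_linVF, fischer_comm]
    exact h S' (Submodule.subset_span hS')

end Homological

/-! ### Taylor polynomials by integration along rays. -/

section Taylor

variable {τ : Type*} [Fintype τ] [DecidableEq τ]

/-- The point `y` with the coordinates in `s` multiplied by `t`. -/
def rayPt (s : Finset τ) (t : ℝ) (y : τ → ℝ) : τ → ℝ := fun i => if i ∈ s then t * y i else y i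

/-- The point `y` with the coordinates outside `s` replaced by zero. -/
def part (s : Finset τ) (y : τ → ℝ) : τ → ℝ := fun i => if i ∈ s then y i else 0

omit [Fintype τ] in
@[simp] theorem rayPt_one (s : Finset τ) (y : τ → ℝ) : rayPt s 1 y = y := by
  ext i; simp [rayPt]

theorem norm_rayPt_le (s : Finset τ) {t : ℝ} (ht : t ∈ Set.Icc (0 : ℝ) 1) (y : τ → ℝ) :
    ‖rayPt s t y‖ ≤ ‖y‖ := by
  refine (pi_norm_le_iff_of_nonneg (norm_nonneg _)).2 fun i => ?_
  have h := norm_le_pi_norm y i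
  rw [rayPt]
  split_ifs
  · rw [norm_mul, Real.norm_of_nonneg ht.1]
    exact (mul_le_of_le_one_left (norm_nonneg _) ht.2).trans h
  · exact h

theorem norm_part_rayPt_le (s : Finset τ) {t : ℝ} (ht : t ∈ Set.Icc (0 : ℝ) 1) (y : τ → ℝ) :
    ‖part s (rayPt s t y)‖ ≤ ‖part s y‖ := by
  have h : part s (rayPt s t y) = rayPt s t (part s y) := by
    ext i
    by_cases hi : i ∈ s <;> simp [part, rayPt, hi]
  rw [h]
  exact norm_rayPt_le s ht _

omit [Fintype τ] in
theorem hasDerivAt_rayPt (s : Finset τ) (y : τ → ℝ) (t : ℝ) :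
    HasDerivAt (fun t => rayPt s t y) (part s y) t := by
  refine hasDerivAt_pi.2 fun i => ?_
  by_cases hi : i ∈ s
  · simpa [rayPt, part, hi] using (hasDerivAt_id t).mul_const (y i)
  · simpa [rayPt, part, hi] using hasDerivAt_const t (y i)

omit [Fintype τ] in
theorem part_eq_sum (s : Finset τ) (y : τ → ℝ) :
    part s y = ∑ i ∈ s, y i • (Pi.single i 1 : τ → ℝ) := by
  ext j
  simp only [part, Finset.sum_apply, Pi.smul_apply, smul_eq_mul, Pi.single_apply, mul_ite, mul_one,
    mul_zero, Finset.sum_ite_eq]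

theorem eval_monomial_rayPt (s : Finset τ) (t : ℝ) (y : τ → ℝ) (m : τ →₀ ℕ) (c : ℝ) :
    eval (rayPt s t y) (monomial m c) = t ^ (∑ i ∈ s, m i) * eval y (monomial m c) := by
  rw [eval_monomial, eval_monomial, Finsupp.prod_fintype _ _ (fun i => pow_zero _),
    Finsupp.prod_fintype _ _ (fun i => pow_zero _)]
  have h : ∀ i, rayPt s t y i = (if i ∈ s then t else 1) * y i := fun i => by
    by_cases hi : i ∈ s <;> simp [rayPt, hi]
  simp_rw [h, mul_pow, Finset.prod_mul_distrib, ite_pow, one_pow]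
  rw [Finset.prod_ite_mem, Finset.univ_inter, Finset.prod_pow_eq_pow_sum]
  ring

/-- The primitive along rays in the directions `s` of the one-form `∑ i ∈ s, q i dy_i`. -/
noncomputable def primitive (s : Finset τ) (q : τ → MvPolynomial τ ℝ) : MvPolynomial τ ℝ :=
  ∑ i ∈ s, ∑ m ∈ (q i).support,
    monomial (m + Finsupp.single i 1) (coeff m (q i) / ((∑ j ∈ s, m j : ℕ) + 1))

omit [Fintype τ] [DecidableEq τ] in
theorem primitive_mem_restrictSupport (s : Finset τ) {q : τ → MvPolynomial τ ℝ}
    {A : Set (τ →₀ ℕ)}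
    (h : ∀ i ∈ s, ∀ m ∈ (q i).support, m + Finsupp.single i 1 ∈ A) :
    primitive s q ∈ restrictSupport ℝ A :=
  Submodule.sum_mem _ fun i hi => Submodule.sum_mem _ fun m hm =>
    (monomial_mem_restrictSupport ℝ).2 (Or.inl (h i hi m hm))

/-- Scaling the variables in s by t multiplies a monomial by t to the power of its degree in s, so
dividing by that degree plus one antidifferentiates in t. Only the radial derivative matters; the
one-form need not be closed. -/
theorem hasDerivAt_eval_primitive (s : Finset τ) (q : τ → MvPolynomial τ ℝ) (y : τ → ℝ) (t : ℝ) :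
    HasDerivAt (fun t => eval (rayPt s t y) (primitive s q))
      (∑ i ∈ s, y i * eval (rayPt s t y) (q i)) t := by
  have hmon : ∀ i ∈ s, ∀ m ∈ (q i).support,
      HasDerivAt (fun t => eval (rayPt s t y)
          (monomial (m + Finsupp.single i 1) (coeff m (q i) / ((∑ j ∈ s, m j : ℕ) + 1))))
        (y i * eval (rayPt s t y) (monomial m (coeff m (q i)))) t := by
    intro i hi m _
    have hsum : ∑ j ∈ s, (m + Finsupp.single i 1 : τ →₀ ℕ) j = ∑ j ∈ s, m j + 1 := by
      simp only [Finsupp.add_apply, Finset.sum_add_distrib, Finsupp.single_apply]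
      rw [Finset.sum_ite_eq, if_pos hi]
    have hne : (((∑ j ∈ s, m j : ℕ) : ℝ) + 1) ≠ 0 := by positivity
    have hev : eval y (monomial (m + Finsupp.single i 1)
        (coeff m (q i) / ((∑ j ∈ s, m j : ℕ) + 1))) =
        y i * eval y (monomial m (coeff m (q i))) / ((∑ j ∈ s, m j : ℕ) + 1) := by
      have : monomial (m + Finsupp.single i 1) (coeff m (q i) / ((∑ j ∈ s, m j : ℕ) + 1)) =
          C ((((∑ j ∈ s, m j : ℕ) : ℝ) + 1)⁻¹) * (X i * monomial m (coeff m (q i))) := by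
        rw [X, monomial_mul, C_mul_monomial, add_comm m]
        congr 1
        ring
      rw [this, map_mul, map_mul, eval_X, eval_C]
      ring
    simp_rw [eval_monomial_rayPt]
    rw [hsum, hev]
    have h := (hasDerivAt_pow (∑ j ∈ s, m j + 1) t).mul_const
      (y i * eval y (monomial m (coeff m (q i))) / ((∑ j ∈ s, m j : ℕ) + 1))
    refine h.congr_deriv ?_
    rw [Nat.add_sub_cancel]
    push_cast
    push_cast at hne
    field_simp
  have h : HasDerivAt (fun t => ∑ i ∈ s, ∑ m ∈ (q i).support, eval (rayPt s t y)
      (monomial (m + Finsupp.single i 1) (coeff m (q i) / ((∑ j ∈ s, m j : ℕ) + 1))))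
      (∑ i ∈ s, ∑ m ∈ (q i).support,
        y i * eval (rayPt s t y) (monomial m (coeff m (q i)))) t :=
    HasDerivAt.fun_sum fun i hi => HasDerivAt.fun_sum fun m hm => hmon i hi m hm
  convert h using 1
  · ext t
    simp only [primitive, map_sum]
  · refine Finset.sum_congr rfl fun i _ => ?_
    rw [← Finset.mul_sum, ← map_sum, ← (q i).as_sum]

theorem eval_primitive_rayPt_zero (s : Finset τ) (q : τ → MvPolynomial τ ℝ) (y : τ → ℝ) :
    eval (rayPt s 0 y) (primitive s q) = 0 := by
  simp only [primitive, map_sum]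
  refine Finset.sum_eq_zero fun i hi => Finset.sum_eq_zero fun m _ => ?_
  rw [eval_monomial_rayPt, zero_pow, zero_mul]
  have : 0 < ∑ j ∈ s, (m + Finsupp.single i 1 : τ →₀ ℕ) j :=
    Finset.sum_pos' (fun _ _ => Nat.zero_le _) ⟨i, hi, by simp⟩
  exact this.ne'

/-- Integration along rays of an approximation of the partial derivatives by polynomials. -/
theorem isBigO_sub_primitive (s : Finset τ) {f : (τ → ℝ) → ℝ} {g : (τ → ℝ) → ℝ}
    {q : τ → MvPolynomial τ ℝ} (hf : ∀ᶠ y in 𝓝 0, DifferentiableAt ℝ f y)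
    (hg : ∀ t ∈ Set.Icc (0 : ℝ) 1, ∀ y, ‖g (rayPt s t y)‖ ≤ ‖g y‖)
    (hq : ∀ i ∈ s, (fun y => fderiv ℝ f y (Pi.single i 1) - eval y (q i)) =O[𝓝 0] g) :
    (fun y => f y - f (rayPt s 0 y) - eval y (primitive s q)) =O[𝓝 0]
      fun y => ‖part s y‖ * g y := by
  have hq' : ∀ i : τ, ∃ c : ℝ, 0 ≤ c ∧ ∀ᶠ y in 𝓝 0, i ∈ s →
      ‖fderiv ℝ f y (Pi.single i 1) - eval y (q i)‖ ≤ c * ‖g y‖ := by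
    intro i
    by_cases hi : i ∈ s
    · obtain ⟨c, hc, h⟩ := (hq i hi).exists_nonneg
      exact ⟨c, hc, h.bound.mono fun y hy _ => hy⟩
    · exact ⟨0, le_rfl, Eventually.of_forall fun y h => absurd h hi⟩
  choose c hc hcb using hq'
  obtain ⟨δ, hδ, hball⟩ := Metric.eventually_nhds_iff_ball.1 (hf.and (eventually_all.2 hcb))
  refine IsBigO.of_bound (∑ i ∈ s, c i) ?_
  filter_upwards [Metric.ball_mem_nhds (0 : τ → ℝ) hδ] with y hy
  have hmem : ∀ t ∈ Set.Icc (0 : ℝ) 1, rayPt s t y ∈ Metric.ball (0 : τ → ℝ) δ := fun t ht => by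
    rw [mem_ball_zero_iff] at hy ⊢
    exact (norm_rayPt_le s ht y).trans_lt hy
  have hderiv : ∀ t ∈ Set.Icc (0 : ℝ) 1,
      HasDerivAt (fun t => f (rayPt s t y) - eval (rayPt s t y) (primitive s q))
        (∑ i ∈ s, y i * (fderiv ℝ f (rayPt s t y) (Pi.single i 1) -
          eval (rayPt s t y) (q i))) t := fun t ht => by
    have h1 := ((hball _ (hmem t ht)).1.hasFDerivAt.comp_hasDerivAt t
      (hasDerivAt_rayPt s y t)).sub (hasDerivAt_eval_primitive s q y t)
    refine h1.congr_deriv ?_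
    rw [part_eq_sum, map_sum, ← Finset.sum_sub_distrib]
    refine Finset.sum_congr rfl fun i _ => ?_
    rw [map_smul, smul_eq_mul]
    ring
  have hbound : ∀ t ∈ Set.Ico (0 : ℝ) 1,
      ‖∑ i ∈ s, y i * (fderiv ℝ f (rayPt s t y) (Pi.single i 1) - eval (rayPt s t y) (q i))‖ ≤
        (∑ i ∈ s, c i) * (‖part s y‖ * ‖g y‖) := fun t ht => by
    have ht' := Set.Ico_subset_Icc_self ht
    rw [Finset.sum_mul]
    refine norm_sum_le_of_le _ fun i hi => ?_
    have h1 : ‖y i‖ ≤ ‖part s y‖ := by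
      have := norm_le_pi_norm (part s y) i
      simpa [part, hi] using this
    have h2 := ((hball _ (hmem t ht')).2 i hi).trans
      (mul_le_mul_of_nonneg_left (hg t ht' y) (hc i))
    rw [norm_mul]
    calc _ ≤ ‖part s y‖ * (c i * ‖g y‖) :=
          mul_le_mul h1 h2 (norm_nonneg _) (norm_nonneg _)
      _ = _ := by ring
  -- Mean value inequality on [0, 1]. The primitive vanishes at t = 0, leaving only the value of f
  -- there.
  have := norm_image_sub_le_of_norm_deriv_le_segment_01'
    (fun t ht => (hderiv t ht).hasDerivWithinAt) hbound
  rw [rayPt_one, eval_primitive_rayPt_zero, sub_zero, sub_right_comm] at this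
  rwa [norm_mul, norm_norm]

theorem _root_.ContDiffAt.fderiv_apply_const {E : Type*} [NormedAddCommGroup E] [NormedSpace ℝ E]
    {f : E → ℝ} {x : E} {r : ℕ}
    (hf : ContDiffAt ℝ ((r + 1 : ℕ) : WithTop ℕ∞) f x) (v : E) :
    ContDiffAt ℝ (r : WithTop ℕ∞) (fun y => fderiv ℝ f y v) x :=
  (hf.fderiv_right (by norm_cast)).clm_apply contDiffAt_const

theorem _root_.ContDiffAt.eventually_differentiableAt {E : Type*} [NormedAddCommGroup E]
    [NormedSpace ℝ E] {f : E → ℝ} {x : E} {r : ℕ}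
    (hf : ContDiffAt ℝ ((r + 1 : ℕ) : WithTop ℕ∞) f x) :
    ∀ᶠ y in 𝓝 x, DifferentiableAt ℝ f y :=
  (hf.eventually (by simp)).mono fun y hy => hy.differentiableAt (by norm_cast)

omit [Fintype τ] [DecidableEq τ] in
theorem weight_one_add_single (m : τ →₀ ℕ) (i : τ) :
    Finsupp.weight (fun _ => 1 : τ → ℕ) (m + Finsupp.single i 1) =
      Finsupp.weight (fun _ => 1 : τ → ℕ) m + 1 := by
  simp [Finsupp.weight_single]

/-- Taylor approximation by a polynomial at the origin. -/
theorem exists_taylor (r : ℕ) : ∀ {f : (τ → ℝ) → ℝ}, ContDiffAt ℝ (r : WithTop ℕ∞) f 0 →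
    ∃ p : MvPolynomial τ ℝ, p ∈ restrictSupport ℝ {s | Finsupp.weight (fun _ => 1 : τ → ℕ) s < r} ∧
      (fun y => f y - eval y p) =O[𝓝 0] fun y => ‖y‖ ^ r := by
  induction r with
  | zero =>
    intro f hf
    refine ⟨0, Submodule.zero_mem _, ?_⟩
    simpa using hf.continuousAt.tendsto.isBigO_one ℝ
  | succ r ih =>
    intro f hf
    -- Approximations of the first partial derivatives to order r are integrated radially; only the
    -- constant f(0) has to be added.
    choose q hqs hq using fun i : τ => ih (hf.fderiv_apply_const (Pi.single i 1))
    have h0 : ∀ y : τ → ℝ, rayPt Finset.univ 0 y = 0 := fun y => by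
      ext i; simp [rayPt]
    have h1 : ∀ y : τ → ℝ, part Finset.univ y = y := fun y => by
      ext i; simp [part]
    refine ⟨C (f 0) + primitive Finset.univ q, Submodule.add_mem _ ?_ ?_, ?_⟩
    · refine (monomial_mem_restrictSupport ℝ).2 (Or.inl ?_)
      simp
    · refine primitive_mem_restrictSupport _ fun i _ m hm => ?_
      have := hqs i hm
      simp only [Set.mem_ofPred_eq, weight_one_add_single] at this ⊢
      omega
    · have := isBigO_sub_primitive Finset.univ (g := fun y => ‖y‖ ^ r)
        hf.eventually_differentiableAt (fun t ht y => ?_) (fun i _ => hq i)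
      · simp only [h0, h1] at this
        simpa [sub_sub, pow_succ'] using this
      · simp only [norm_pow, norm_norm]
        exact pow_le_pow_left₀ (norm_nonneg _) (norm_rayPt_le _ ht y) r

end Taylor

/-! ### Taylor approximation respecting vanishing at z = 0. -/

section PhaseTaylor

variable {σ κ : Type*} [Fintype σ] [Fintype κ] [DecidableEq σ] [DecidableEq κ]

/-- The indices of the phase-space variables. -/
def phaseVars : Finset (σ ⊕ κ) := Finset.univ.map Function.Embedding.inr

theorem norm_part_phaseVars (y : σ ⊕ κ → ℝ) : ‖part phaseVars y‖ = ‖fun j => y (Sum.inr j)‖ := by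
  apply le_antisymm
  · refine (pi_norm_le_iff_of_nonneg (norm_nonneg _)).2 ?_
    rintro (i | j)
    · simp [part, phaseVars]
    · simpa [part, phaseVars] using norm_le_pi_norm (fun j => y (Sum.inr j)) j
  · refine (pi_norm_le_iff_of_nonneg (norm_nonneg _)).2 fun j => ?_
    simpa [part, phaseVars] using norm_le_pi_norm (part phaseVars y) (Sum.inr j)

theorem norm_bound_rayPt (a b : ℕ) (t : ℝ) (ht : t ∈ Set.Icc (0 : ℝ) 1) (y : σ ⊕ κ → ℝ) :
    ‖‖part phaseVars (rayPt phaseVars t y)‖ ^ a * ‖rayPt phaseVars t y‖ ^ b‖ ≤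
      ‖‖part phaseVars y‖ ^ a * ‖y‖ ^ b‖ := by
  simp only [norm_mul, norm_pow, norm_norm]
  have h1 := norm_part_rayPt_le phaseVars ht y
  have h2 := norm_rayPt_le phaseVars ht y
  gcongr

omit [DecidableEq σ] [DecidableEq κ] [Fintype σ] [Fintype κ] in
theorem weight_phase_add_single (m : σ ⊕ κ →₀ ℕ) (j : κ) :
    Finsupp.weight phaseWeight (m + Finsupp.single (Sum.inr j) 1) =
      Finsupp.weight phaseWeight m + 1 := by
  simp [Finsupp.weight_single, phaseWeight]

omit [DecidableEq σ] [DecidableEq κ] [Fintype σ] in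
theorem primitive_phaseVars_mem {q : σ ⊕ κ → MvPolynomial (σ ⊕ κ) ℝ} {d e r : ℕ}
    (hd : ∀ j, q (Sum.inr j) ∈ restrictSupport ℝ {s | Finsupp.weight (fun _ => 1) s < d})
    (he : ∀ j, q (Sum.inr j) ∈ filtration (fun _ => 1) e)
    (hr : ∀ j, q (Sum.inr j) ∈ filtration phaseWeight r) :
    primitive phaseVars q ∈ restrictSupport ℝ {s | Finsupp.weight (fun _ => 1) s < d + 1} ∧
    primitive phaseVars q ∈ filtration (fun _ => 1) (e + 1) ∧
    primitive phaseVars q ∈ filtration phaseWeight (r + 1) := by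
  refine ⟨primitive_mem_restrictSupport _ ?_, primitive_mem_restrictSupport _ ?_,
    primitive_mem_restrictSupport _ ?_⟩ <;>
  · intro i hi m hm
    obtain ⟨j, -, rfl⟩ := Finset.mem_map.1 hi
    have h1 := hd j hm
    have h2 := he j hm
    have h3 := hr j hm
    simp only [Set.mem_ofPred_eq, weight_one_add_single, weight_phase_add_single,
      Function.Embedding.inr_apply] at h1 h2 h3 ⊢
    omega

/-- Taylor approximation of a function vanishing with order `r` (one or two) at `z = 0`, with a
remainder estimate reflecting this. -/
theorem exists_phaseTaylor (k r : ℕ) (hr : r = 1 ∨ r = 2) {f : (σ ⊕ κ → ℝ) → ℝ}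
    (hf : ContDiffAt ℝ ((k + 2 : ℕ) : WithTop ℕ∞) f 0)
    (h0 : ∀ᶠ y in 𝓝 0, f (rayPt phaseVars 0 y) = 0)
    (h1 : ∀ j, fderiv ℝ f 0 (Pi.single (Sum.inr j) 1) = 0)
    (h2 : r = 2 → ∀ j, ∀ᶠ y in 𝓝 0,
      fderiv ℝ f (rayPt phaseVars 0 y) (Pi.single (Sum.inr j) 1) = 0) :
    ∃ p : MvPolynomial (σ ⊕ κ) ℝ,
      p ∈ restrictSupport ℝ {s | Finsupp.weight (fun _ => 1) s < k + 2} ∧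
      p ∈ filtration (fun _ => 1) 2 ∧ p ∈ filtration phaseWeight r ∧
      (fun y => f y - eval y p) =O[𝓝 0]
        fun y => ‖fun j => y (Sum.inr j)‖ ^ r * ‖y‖ ^ (k + 2 - r) := by
  have hD : ∀ i, ContDiffAt ℝ ((k + 1 : ℕ) : WithTop ℕ∞)
      (fun y => fderiv ℝ f y (Pi.single i 1)) 0 := fun i => hf.fderiv_apply_const _
  obtain ⟨q, hqd, hqe, hqr, hq⟩ : ∃ q : σ ⊕ κ → MvPolynomial (σ ⊕ κ) ℝ,
      (∀ j, q (Sum.inr j) ∈ restrictSupport ℝ {s | Finsupp.weight (fun _ => 1) s < k + 1}) ∧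
      (∀ j, q (Sum.inr j) ∈ filtration (fun _ => 1) 1) ∧
      (∀ j, q (Sum.inr j) ∈ filtration phaseWeight (r - 1)) ∧
      ∀ j, (fun y => fderiv ℝ f y (Pi.single (Sum.inr j) 1) - eval y (q (Sum.inr j))) =O[𝓝 0]
        fun y => ‖part phaseVars y‖ ^ (r - 1) * ‖y‖ ^ (k + 2 - r) := by
    rcases hr with rfl | rfl
    -- Case r = 1: the first z-derivatives are approximated to order k + 1. They vanish at the
    -- origin, so the approximations have no constant term and the primitive has degree at least 2.
    · choose q hqs hq using fun i => exists_taylor (k + 1) (hD i)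
      refine ⟨q, fun j => hqs _, fun j s hs => ?_, fun j => mem_filtration_zero _ _, fun j => ?_⟩
      · have hz : coeff 0 (q (Sum.inr j)) = 0 := by
          have h : fderiv ℝ f 0 (Pi.single (Sum.inr j) 1) - eval 0 (q (Sum.inr j)) = 0 :=
            IsBigO.eq_zero_of_norm_pow (n := k + 1) (x₀ := 0)
              (f := fun y => fderiv ℝ f y (Pi.single (Sum.inr j) 1) - eval y (q (Sum.inr j))) (by simpa using hq (Sum.inr j))
              (Nat.succ_ne_zero k)
          rw [h1, zero_sub, neg_eq_zero] at h
          rwa [← constantCoeff_eq, ← eval_zero]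
        rw [Set.mem_ofPred_eq, Nat.one_le_iff_ne_zero]
        intro hw
        have hs0 : s = 0 := by
          ext i
          have := Finsupp.le_weight (fun _ => 1 : σ ⊕ κ → ℕ) (s := i) one_ne_zero s
          simp only [Finsupp.coe_zero, Pi.zero_apply]
          omega
        rw [hs0] at hs
        exact mem_support_iff.1 hs hz
      · simpa using hq (Sum.inr j)
    -- Case r = 2: the second z-derivatives are approximated to order k and integrated twice. Each
    -- integration contributes one factor |z| to the remainder and one z-degree to the polynomial.
    · have hDD : ∀ i l, ContDiffAt ℝ (k : WithTop ℕ∞)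
          (fun y => fderiv ℝ (fun y => fderiv ℝ f y (Pi.single i 1)) y (Pi.single l 1)) 0 :=
        fun i l => (hD i).fderiv_apply_const _
      choose Q hQs hQ using fun i l => exists_taylor k (hDD i l)
      have hm : ∀ i, _ := fun i => primitive_phaseVars_mem (q := Q i) (fun j => hQs i _)
        (fun j => mem_filtration_zero _ _) (fun j => mem_filtration_zero _ _)
      refine ⟨fun i => primitive phaseVars (Q i), fun j => (hm _).1, fun j => (hm _).2.1,
        fun j => (hm _).2.2, fun j => ?_⟩
      have := isBigO_sub_primitive phaseVars (g := fun y => ‖part phaseVars y‖ ^ 0 * ‖y‖ ^ k)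
        (hD (Sum.inr j)).eventually_differentiableAt (norm_bound_rayPt 0 k)
        (fun l _ => by simpa using hQ (Sum.inr j) l)
      refine (this.congr' ?_ ?_)
      · filter_upwards [h2 rfl j] with y hy
        rw [hy, sub_zero]
      · simp [EventuallyEq]
  obtain ⟨hp1, hp2, hp3⟩ := primitive_phaseVars_mem hqd hqe hqr
  refine ⟨primitive phaseVars q, hp1, hp2, ?_, ?_⟩
  · rwa [Nat.sub_add_cancel (by omega)] at hp3
  · have := isBigO_sub_primitive phaseVars
      (g := fun y => ‖part phaseVars y‖ ^ (r - 1) * ‖y‖ ^ (k + 2 - r))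
      (hf.eventually_differentiableAt) (norm_bound_rayPt (r - 1) (k + 2 - r)) (q := q) ?_
    · refine this.congr' ?_ ?_
      · filter_upwards [h0] with y hy
        rw [hy, sub_zero]
      · refine Eventually.of_forall fun y => ?_
        dsimp only
        rw [← mul_assoc, ← pow_succ', Nat.sub_add_cancel (by omega), norm_part_phaseVars]
    · intro i hi
      obtain ⟨j, -, rfl⟩ := Finset.mem_map.1 hi
      exact hq j

end PhaseTaylor

/-! ### Symplectic shears. -/

section Shear

/-- Multiplication by the standard symplectic matrix, so that `hamVF K = symp (∇ K)`. -/
def symp {N : ℕ} (v : Phase N) : Phase N :=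
  Sum.elim (fun i => v (Sum.inr i)) (fun i => -v (Sum.inl i))

/-- The linear form `⟨v, ·⟩`. -/
noncomputable def dotCLM {N : ℕ} (v : Phase N) : Phase N →L[ℝ] ℝ :=
  ∑ j, v j • ContinuousLinearMap.proj j

theorem dotCLM_apply {N : ℕ} (v x : Phase N) : dotCLM v x = v ⬝ᵥ x := by
  simp [dotCLM, dotProduct]

theorem symp_eq_vecMul {N : ℕ} (v : Phase N) : symp v = v ᵥ* Matrix.J (Fin N) ℝ := by
  rw [Matrix.J, Matrix.vecMul_fromBlocks]
  ext (i | i) <;> simp [symp, Matrix.vecMul_neg]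

theorem symp_eq_mulVec {N : ℕ} (v : Phase N) : Matrix.J (Fin N) ℝ *ᵥ v = -symp v := by
  rw [symp_eq_vecMul, ← Matrix.mulVec_transpose, Matrix.J_transpose, Matrix.neg_mulVec, neg_neg]

theorem symp_dotProduct {N : ℕ} (u v : Phase N) : symp u ⬝ᵥ v = -(u ⬝ᵥ symp v) := by
  rw [symp_eq_vecMul, ← Matrix.dotProduct_mulVec, symp_eq_mulVec, dotProduct_neg]

theorem dotProduct_symp_self {N : ℕ} (v : Phase N) : v ⬝ᵥ symp v = 0 := by
  have h := symp_dotProduct v v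
  rw [dotProduct_comm] at h
  linarith

/-- The flow of the Hamiltonian `c ε^a ⟨v, x⟩^(b+1) / (b+1)`. -/
noncomputable def shear {m N : ℕ} (c : ℝ) (a : Fin m → ℕ) (b : ℕ) (v : Phase N) :
    Param m → Phase N → Phase N :=
  fun ε x => x + (c * (∏ i, ε i ^ a i) * dotCLM v x ^ b) • symp v

theorem contDiff_shear {m N : ℕ} (c : ℝ) (a : Fin m → ℕ) (b : ℕ) (v : Phase N) :
    ContDiff ℝ ∞ (Function.uncurry (shear c a b v)) := by
  have h : Function.uncurry (shear c a b v) = fun y : Param m × Phase N =>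
      y.2 + (c * (∏ i, y.1 i ^ a i) * dotCLM v y.2 ^ b) • symp v := rfl
  rw [h]
  have h1 : ContDiff ℝ ∞ fun y : Param m × Phase N => ∏ i, y.1 i ^ a i :=
    contDiff_prod fun i _ => by fun_prop
  fun_prop

/-- Because v is orthogonal to `symp v`, the form ⟨v, ·⟩ is conserved. Hence the flow is affine in
time and is inverted by changing the sign of c. -/
theorem dotCLM_shear {m N : ℕ} (c : ℝ) (a : Fin m → ℕ) (b : ℕ) (v : Phase N) (ε : Param m)
    (x : Phase N) : dotCLM v (shear c a b v ε x) = dotCLM v x := by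
  rw [shear, map_add, map_smul, dotCLM_apply v (symp v), dotProduct_symp_self]
  simp

theorem shear_neg_shear {m N : ℕ} (c : ℝ) (a : Fin m → ℕ) (b : ℕ) (v : Phase N) (ε : Param m)
    (x : Phase N) : shear (-c) a b v ε (shear c a b v ε x) = x := by
  rw [shear, dotCLM_shear, shear]
  simp only [neg_mul, neg_smul]
  abel

theorem hasFDerivAt_shear {m N : ℕ} (c : ℝ) (a : Fin m → ℕ) (b : ℕ) (v : Phase N) (ε : Param m)
    (x : Phase N) : HasFDerivAt (shear c a b v ε) (ContinuousLinearMap.id ℝ (Phase N) +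
      (c * (∏ i, ε i ^ a i) * (b * dotCLM v x ^ (b - 1))) • (dotCLM v).smulRight (symp v)) x := by
  have h1 : HasFDerivAt (fun x => dotCLM v x ^ b) ((b * dotCLM v x ^ (b - 1)) • dotCLM v) x := by
    simpa using (dotCLM v).hasFDerivAt.pow b (x := x)
  have h2 := (hasFDerivAt_id x).add
    ((h1.const_mul (c * (∏ i, ε i ^ a i))).smul_const (symp v))
  refine h2.congr_fderiv ?_
  ext y
  simp [smul_smul, mul_assoc]

/-- For the transvection A = 1 + t (symp v) vᵀ, the two first-order terms of A J Aᵀ cancel and the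
second-order term contains the factor v · symp v = 0. -/
theorem toMatrix_transvection_mem {N : ℕ} (t : ℝ) (v : Phase N) :
    LinearMap.toMatrix' ((ContinuousLinearMap.id ℝ (Phase N) +
      t • (dotCLM v).smulRight (symp v) : Phase N →L[ℝ] Phase N) : Phase N →ₗ[ℝ] Phase N) ∈
      Matrix.symplecticGroup (Fin N) ℝ := by
  have h : LinearMap.toMatrix' ((ContinuousLinearMap.id ℝ (Phase N) +
      t • (dotCLM v).smulRight (symp v) : Phase N →L[ℝ] Phase N) : Phase N →ₗ[ℝ] Phase N) =
      1 + t • Matrix.vecMulVec (symp v) v := by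
    ext i j
    rw [LinearMap.toMatrix'_apply]
    simp [dotCLM_apply, Matrix.one_apply, Pi.single_apply, Matrix.vecMulVec_apply]
    exact Or.inl (mul_comm _ _)
  rw [h, SymplecticGroup.mem_iff]
  simp only [Matrix.transpose_add, Matrix.transpose_one, Matrix.transpose_smul,
    Matrix.transpose_vecMulVec, Matrix.add_mul, Matrix.one_mul, Matrix.mul_add, Matrix.mul_one,
    Matrix.smul_mul, Matrix.mul_smul, Matrix.vecMulVec_mul, Matrix.mul_vecMulVec,
    ← symp_eq_vecMul]
  have h0 : Matrix.vecMulVec (symp v) (symp v) *ᵥ v = 0 := by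
    rw [Matrix.vecMulVec_mulVec, dotProduct_comm, dotProduct_symp_self]
    simp
  rw [Matrix.add_mulVec, Matrix.smul_mulVec, h0, symp_eq_mulVec, smul_zero, add_zero,
    Matrix.neg_vecMulVec, smul_neg, add_neg_cancel_right]

theorem symplectic_shear {m N : ℕ} (c : ℝ) (a : Fin m → ℕ) (b : ℕ) (v : Phase N) (ε : Param m)
    (x : Phase N) :
    LinearMap.toMatrix' (fderiv ℝ (shear c a b v ε) x : Phase N →ₗ[ℝ] Phase N) ∈
      Matrix.symplecticGroup (Fin N) ℝ := by
  rw [(hasFDerivAt_shear c a b v ε x).fderiv]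
  exact toMatrix_transvection_mem _ v

end Shear

/-! ### The lower-order phase space inside the full one. -/

section Extend

variable {n : ℕ}

@[simp] theorem extend_inl_zero (z : Phase n) : extend z (Sum.inl 0) = 0 := rfl
@[simp] theorem extend_inr_zero (z : Phase n) : extend z (Sum.inr 0) = 0 := rfl
@[simp] theorem extend_inl_succ (z : Phase n) (i : Fin n) :
    extend z (Sum.inl i.succ) = z (Sum.inl i) := rfl
@[simp] theorem extend_inr_succ (z : Phase n) (i : Fin n) :
    extend z (Sum.inr i.succ) = z (Sum.inr i) := rfl

theorem symp_extend (v : Phase n) : symp (extend v) = extend (symp v) := by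
  ext (i | i) <;> refine Fin.cases ?_ (fun i => ?_) i <;> simp [symp]

theorem extend_add_smul (z u : Phase n) (t : ℝ) : extend z + t • extend u = extend (z + t • u) := by
  ext (i | i) <;> refine Fin.cases ?_ (fun i => ?_) i <;> simp

@[simp] theorem restrict_extend (z : Phase n) : restrict (extend z) = z := by
  ext (i | i) <;> simp [restrict]

theorem dotCLM_extend (v : Phase n) (x : Phase (n + 1)) :
    dotCLM (extend v) x = dotCLM v (restrict x) := by
  simp only [dotCLM_apply, dotProduct, Fintype.sum_sum_type, Fin.sum_univ_succ]
  simp [restrict]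

theorem extend_zero : extend (0 : Phase n) = 0 := by
  ext (i | i) <;> refine Fin.cases ?_ (fun i => ?_) i <;> simp

theorem norm_restrict_le (x : Phase (n + 1)) : ‖restrict x‖ ≤ ‖x‖ :=
  (pi_norm_le_iff_of_nonneg (norm_nonneg _)).2 fun _ => norm_le_pi_norm x _

theorem norm_restrict_le_dropP0 (x : Phase (n + 1)) : ‖restrict x‖ ≤ ‖dropP0 x‖ := by
  refine (pi_norm_le_iff_of_nonneg (norm_nonneg _)).2 fun j => ?_
  have h : restrict x j = dropP0 x (Sum.map Fin.succ Fin.succ j) := by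
    rcases j with i | i
    · simp [restrict, dropP0]
    · simp [restrict, dropP0]
  rw [h]
  exact norm_le_pi_norm (dropP0 x) _

theorem norm_dropP0_le (x : Phase (n + 1)) : ‖dropP0 x‖ ≤ ‖x‖ := by
  refine (pi_norm_le_iff_of_nonneg (norm_nonneg _)).2 fun j => ?_
  rw [dropP0, Function.update_apply]
  split_ifs
  · simp
  · exact norm_le_pi_norm x j

theorem dropP0_sub (x y : Phase (n + 1)) : dropP0 (x - y) = dropP0 x - dropP0 y := by
  ext j
  simp only [dropP0, Function.update_apply, Pi.sub_apply]
  split_ifs <;> simp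

theorem restrict_sub (x y : Phase (n + 1)) : restrict (x - y) = restrict x - restrict y := rfl

end Extend

/-! ### Size of polynomials near the origin. -/

section Bounds

variable {m n : ℕ}

theorem norm_eval_monomial_le (s : Fin m ⊕ (Fin n ⊕ Fin n) →₀ ℕ) (c : ℝ) (ε : Param m)
    (z : Phase n) : ‖eval (Sum.elim ε z) (monomial s c)‖ ≤
      ‖c‖ * (‖ε‖ ^ (∑ i, s (Sum.inl i)) * ‖z‖ ^ (∑ j, s (Sum.inr j))) := by
  rw [eval_monomial, Finsupp.prod_fintype _ _ (fun i => pow_zero _), Fintype.prod_sum_type,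
    norm_mul, norm_mul, norm_prod, norm_prod, ← Finset.prod_pow_eq_pow_sum,
    ← Finset.prod_pow_eq_pow_sum]
  simp only [Sum.elim_inl, Sum.elim_inr, norm_pow]
  have h1 := fun i => norm_le_pi_norm ε i
  have h2 := fun i => norm_le_pi_norm z i
  gcongr with i _ i _
  · exact h1 i
  · exact h2 i

/-- Size of a polynomial all of whose monomials have degree at least `i` in `z` and total degree
at least `i + j`. -/
theorem isBigO_eval {i j : ℕ} {p : MvPolynomial (Fin m ⊕ (Fin n ⊕ Fin n)) ℝ}
    (hi : p ∈ filtration phaseWeight i) (hj : p ∈ filtration (fun _ => 1) (i + j)) :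
    (fun y : Param m × Phase n => eval (Sum.elim y.1 y.2) p) =O[𝓝 0]
      fun y => ‖y.2‖ ^ i * ‖y‖ ^ j := by
  have h : (fun y : Param m × Phase n => eval (Sum.elim y.1 y.2) p) = fun y =>
      ∑ s ∈ p.support, eval (Sum.elim y.1 y.2) (monomial s (coeff s p)) := by
    ext y
    conv_lhs => rw [p.as_sum]
    rw [map_sum]
  rw [h]
  refine IsBigO.fun_sum fun s hs => ?_
  refine IsBigO.of_bound ‖coeff s p‖ ?_
  have hi' := hi hs
  have hj' := hj hs
  rw [Set.mem_ofPred_eq, phaseWeight_eq] at hi'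
  rw [Set.mem_ofPred_eq, oneWeight_eq] at hj'
  filter_upwards [Metric.ball_mem_nhds (0 : Param m × Phase n) one_pos] with y hy
  rw [mem_ball_zero_iff] at hy
  refine (norm_eval_monomial_le s _ y.1 y.2).trans ?_
  refine mul_le_mul_of_nonneg_left ?_ (norm_nonneg _)
  rw [norm_mul, norm_pow, norm_pow, norm_norm, norm_norm]
  obtain ⟨b, hb⟩ := Nat.exists_eq_add_of_le hi'
  rw [hb, pow_add]
  calc ‖y.1‖ ^ (∑ i, s (Sum.inl i)) * (‖y.2‖ ^ i * ‖y.2‖ ^ b)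
      = ‖y.2‖ ^ i * (‖y.1‖ ^ (∑ i, s (Sum.inl i)) * ‖y.2‖ ^ b) := by ring
    _ ≤ ‖y.2‖ ^ i * (‖y‖ ^ (∑ i, s (Sum.inl i)) * ‖y‖ ^ b) := by
        have h1 := norm_fst_le y
        have h2 := norm_snd_le y
        gcongr
    _ ≤ ‖y.2‖ ^ i * ‖y‖ ^ j := by
        rw [← pow_add]
        exact mul_le_mul_of_nonneg_left
          (pow_le_pow_of_le_one (norm_nonneg _) hy.le (by omega)) (by positivity)

end Bounds

/-! ### Polynomial canonical changes of variables. -/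

section ChangeOfVariables

variable {m n : ℕ}

/-- A globally defined canonical change of variables `Φ` with inverse `Ψ` that leaves `(q_0, p_0)`
untouched and whose inverse acts polynomially on the lower-order phase space, the pullback of
polynomials being `θ`. If `r = 2`, the change of variables moreover fixes `(q, p) = 0`. -/
structure PolyChange (r : ℕ) (Φ Ψ : Param m → Phase (n + 1) → Phase (n + 1))
    (θ : MvPolynomial (Fin m ⊕ (Fin n ⊕ Fin n)) ℝ →ₐ[ℝ]
      MvPolynomial (Fin m ⊕ (Fin n ⊕ Fin n)) ℝ) : Prop where
  smooth : ContDiff ℝ ∞ (Function.uncurry Φ)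
  smooth_inv : ContDiff ℝ ∞ (Function.uncurry Ψ)
  left_inv : ∀ ε x, Ψ ε (Φ ε x) = x
  right_inv : ∀ ε x, Φ ε (Ψ ε x) = x
  symplectic : ∀ ε x, LinearMap.toMatrix' (fderiv ℝ (Φ ε) x : Phase (n + 1) →ₗ[ℝ] Phase (n + 1)) ∈
    Matrix.symplecticGroup (Fin (n + 1)) ℝ
  map_zero : Φ 0 0 = 0
  hasFDerivAt_zero : HasFDerivAt (Φ 0) (ContinuousLinearMap.id ℝ (Phase (n + 1))) 0
  q0 : ∀ ε x, Φ ε x (Sum.inl 0) = x (Sum.inl 0)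
  p0 : ∀ ε x (t : ℝ), Ψ ε (x + t • Pi.single (Sum.inr 0) 1) =
    Ψ ε x + t • Pi.single (Sum.inr 0) 1
  pullback : ∀ ε z, Ψ ε (extend z) = extend fun j => eval (Sum.elim ε z) (θ (X (Sum.inr j)))
  pullback_par : ∀ i, θ (X (Sum.inl i)) = X (Sum.inl i)
  raises_one : Raises (fun _ => 1) 0 θ
  raises_phase : r = 2 → Raises phaseWeight 0 θ
  sub_isBigO : r = 2 → (fun y : Param m × Phase (n + 1) => Φ y.1 y.2 - y.2) =O[𝓝 0]
    fun y => ‖(y.1, dropP0 y.2)‖ * ‖restrict y.2‖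

theorem PolyChange.eval_pullback {r : ℕ} {Φ Ψ : Param m → Phase (n + 1) → Phase (n + 1)}
    {θ : MvPolynomial (Fin m ⊕ (Fin n ⊕ Fin n)) ℝ →ₐ[ℝ] MvPolynomial (Fin m ⊕ (Fin n ⊕ Fin n)) ℝ}
    (h : PolyChange r Φ Ψ θ) (ε : Param m) (z : Phase n)
    (p : MvPolynomial (Fin m ⊕ (Fin n ⊕ Fin n)) ℝ) :
    eval (Sum.elim ε z) (θ p) =
      eval (Sum.elim ε fun j => eval (Sum.elim ε z) (θ (X (Sum.inr j)))) p := by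
  have key : (aeval (R := ℝ) (Sum.elim ε z : _ → ℝ)).comp θ =
      aeval (R := ℝ) (Sum.elim ε fun j => eval (Sum.elim ε z) (θ (X (Sum.inr j))) : _ → ℝ) := by
    apply MvPolynomial.algHom_ext
    rintro (i | j)
    · simp [h.pullback_par]
    · simp
  have := AlgHom.congr_fun key p
  simpa [coe_aeval_eq_eval] using this

theorem PolyChange.id (r : ℕ) : PolyChange r (fun _ x => x) (fun _ x => x)
    (AlgHom.id ℝ (MvPolynomial (Fin m ⊕ (Fin n ⊕ Fin n)) ℝ)) where
  smooth := contDiff_snd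
  smooth_inv := contDiff_snd
  left_inv _ _ := rfl
  right_inv _ _ := rfl
  symplectic ε x := by
    have : LinearMap.toMatrix' (fderiv ℝ (fun x : Phase (n + 1) => x) x :
        Phase (n + 1) →ₗ[ℝ] Phase (n + 1)) = 1 := by
      rw [fderiv_fun_id]
      exact LinearMap.toMatrix'_id
    rw [this]
    exact one_mem _
  map_zero := rfl
  hasFDerivAt_zero := hasFDerivAt_id 0
  q0 _ _ := rfl
  p0 _ _ _ := rfl
  pullback ε z := by simp
  pullback_par _ := rfl
  raises_one := Raises.id _ _
  raises_phase _ := Raises.id _ _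
  sub_isBigO _ := by simpa using isBigO_zero _ _

theorem PolyChange.comp {r : ℕ} {Φ₁ Ψ₁ Φ₂ Ψ₂ : Param m → Phase (n + 1) → Phase (n + 1)}
    {θ₁ θ₂ : MvPolynomial (Fin m ⊕ (Fin n ⊕ Fin n)) ℝ →ₐ[ℝ]
      MvPolynomial (Fin m ⊕ (Fin n ⊕ Fin n)) ℝ}
    (h₁ : PolyChange r Φ₁ Ψ₁ θ₁) (h₂ : PolyChange r Φ₂ Ψ₂ θ₂) :
    PolyChange r (fun ε x => Φ₁ ε (Φ₂ ε x)) (fun ε x => Ψ₂ ε (Ψ₁ ε x)) (θ₁.comp θ₂) where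
  smooth := h₁.smooth.comp (contDiff_fst.prodMk h₂.smooth)
  smooth_inv := h₂.smooth_inv.comp (contDiff_fst.prodMk h₁.smooth_inv)
  left_inv ε x := by rw [h₁.left_inv, h₂.left_inv]
  right_inv ε x := by rw [h₂.right_inv, h₁.right_inv]
  symplectic ε x := by
    have d : ∀ {Φ : Param m → Phase (n + 1) → Phase (n + 1)},
        ContDiff ℝ ∞ (Function.uncurry Φ) → ∀ x, DifferentiableAt ℝ (Φ ε) x := fun hΦ x =>
      ((hΦ.comp (contDiff_const.prodMk contDiff_id)).differentiable (by simp)).differentiableAt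
    have e : fderiv ℝ (fun x => Φ₁ ε (Φ₂ ε x)) x =
        (fderiv ℝ (Φ₁ ε) (Φ₂ ε x)).comp (fderiv ℝ (Φ₂ ε) x) :=
      fderiv_comp x (d h₁.smooth _) (d h₂.smooth _)
    rw [e, ContinuousLinearMap.toLinearMap_comp, LinearMap.toMatrix'_comp]
    exact mul_mem (h₁.symplectic _ _) (h₂.symplectic _ _)
  map_zero := by rw [h₂.map_zero, h₁.map_zero]
  hasFDerivAt_zero := by
    have h : HasFDerivAt (Φ₁ 0) (ContinuousLinearMap.id ℝ (Phase (n + 1))) (Φ₂ 0 0) := by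
      rw [h₂.map_zero]; exact h₁.hasFDerivAt_zero
    exact h.comp 0 h₂.hasFDerivAt_zero
  q0 ε x := by rw [h₁.q0, h₂.q0]
  p0 ε x t := by rw [h₁.p0, h₂.p0]
  pullback ε z := by
    rw [h₁.pullback, h₂.pullback]
    congr 1
    ext j
    rw [AlgHom.comp_apply, h₁.eval_pullback]
  pullback_par i := by rw [AlgHom.comp_apply, h₂.pullback_par, h₁.pullback_par]
  raises_one := h₁.raises_one.comp h₂.raises_one
  raises_phase hr := (h₁.raises_phase hr).comp (h₂.raises_phase hr)
  sub_isBigO hr := by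
    -- Near the origin Φ₂ enlarges |(q, p)| and |(ε, q_0, q, p)| by at most constant factors, so the
    -- estimate for Φ₁ at the image point is one at the original point.
    set ρ : Param m × Phase (n + 1) → ℝ := fun y => ‖(y.1, dropP0 y.2)‖ with hρ
    have hρ0 : Tendsto ρ (𝓝 0) (𝓝 0) := by
      have : Tendsto (fun y : Param m × Phase (n + 1) => ‖y‖) (𝓝 0) (𝓝 0) :=
        tendsto_norm_zero
      refine squeeze_zero (fun _ => norm_nonneg _) (fun y => ?_) this
      exact max_le_max le_rfl (norm_dropP0_le _)
    have hρ1 : ρ =O[𝓝 0] fun _ => (1 : ℝ) := hρ0.isBigO_one ℝ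
    have hb : (fun y : Param m × Phase (n + 1) => Φ₂ y.1 y.2 - y.2) =O[𝓝 0]
        fun y => ‖restrict y.2‖ := by
      simpa using (h₂.sub_isBigO hr).trans (hρ1.mul (isBigO_refl _ _))
    have hres : (fun y : Param m × Phase (n + 1) => ‖restrict (Φ₂ y.1 y.2)‖) =O[𝓝 0]
        fun y => ‖restrict y.2‖ := by
      have h1 : (fun y : Param m × Phase (n + 1) => restrict (Φ₂ y.1 y.2 - y.2)) =O[𝓝 0]
          fun y => ‖restrict y.2‖ :=
        (IsBigO.of_norm_le fun y => norm_restrict_le _).trans hb.norm_left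
      have h2 := h1.add (isBigO_norm_right.2 (isBigO_refl
        (fun y : Param m × Phase (n + 1) => restrict y.2) (𝓝 0)))
      simp only [restrict_sub, sub_add_cancel] at h2
      exact h2.norm_left
    have hrest : (fun y : Param m × Phase (n + 1) => ‖restrict y.2‖) =O[𝓝 0] ρ :=
      IsBigO.of_norm_le fun y => by
        rw [norm_norm]
        exact (norm_restrict_le_dropP0 _).trans (norm_snd_le (y.1, dropP0 y.2))
    have hdrop : (fun y : Param m × Phase (n + 1) => ‖(y.1, dropP0 (Φ₂ y.1 y.2))‖) =O[𝓝 0] ρ := by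
      have h1 : (fun y : Param m × Phase (n + 1) => dropP0 (Φ₂ y.1 y.2 - y.2)) =O[𝓝 0] ρ :=
        ((IsBigO.of_norm_le fun y => norm_dropP0_le _).trans hb.norm_left).trans hrest
      have h2 : (fun y : Param m × Phase (n + 1) => dropP0 y.2) =O[𝓝 0] ρ :=
        IsBigO.of_norm_le fun y => norm_snd_le (y.1, dropP0 y.2)
      have h3 : (fun y : Param m × Phase (n + 1) => y.1) =O[𝓝 0] ρ :=
        IsBigO.of_norm_le fun y => norm_fst_le (y.1, dropP0 y.2)
      have h4 := h1.add h2
      simp only [dropP0_sub, sub_add_cancel] at h4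
      exact (h3.prod_left h4).norm_left
    have htend : Tendsto (fun y : Param m × Phase (n + 1) => (y.1, Φ₂ y.1 y.2)) (𝓝 0) (𝓝 0) := by
      have hc : Continuous (fun y : Param m × Phase (n + 1) => (y.1, Φ₂ y.1 y.2)) :=
        continuous_fst.prodMk h₂.smooth.continuous
      have := hc.tendsto 0
      simp only [Prod.fst_zero, Prod.snd_zero, h₂.map_zero] at this
      exact this
    have h1 := ((h₁.sub_isBigO hr).comp_tendsto htend).trans (hdrop.mul hres)
    have h2 := h1.add (h₂.sub_isBigO hr)
    refine h2.congr_left fun y => ?_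
    simp

/-- The polynomial `ε^a ⟨v, z⟩^b` as a function. -/
theorem eval_powGen (a : Fin m → ℕ) (v : Phase n) (b : ℕ) (ε : Param m) (z : Phase n) :
    eval (Sum.elim ε z) (powGen a v b) = (∏ i, ε i ^ a i) * dotCLM v z ^ b := by
  simp [powGen, linForm, dotCLM_apply, dotProduct]

/-- The pullback of polynomials by the shear generated by `c ε^a ⟨v, z⟩^(b + 1) / (b + 1)`. -/
noncomputable def shearHom (c : ℝ) (a : Fin m → ℕ) (b : ℕ) (v : Phase n) :
    MvPolynomial (Fin m ⊕ (Fin n ⊕ Fin n)) ℝ →ₐ[ℝ] MvPolynomial (Fin m ⊕ (Fin n ⊕ Fin n)) ℝ :=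
  aeval (Sum.elim (fun i => X (Sum.inl i))
    fun j => X (Sum.inr j) + C (symp v j) * (C c * powGen a v b))

theorem shearHom_inl (c : ℝ) (a : Fin m → ℕ) (b : ℕ) (v : Phase n) (i : Fin m) :
    shearHom c a b v (X (Sum.inl i)) = X (Sum.inl i) := by
  simp [shearHom]

theorem shearHom_inr (c : ℝ) (a : Fin m → ℕ) (b : ℕ) (v : Phase n) (j : Fin n ⊕ Fin n) :
    shearHom c a b v (X (Sum.inr j)) =
      X (Sum.inr j) + C (symp v j) * (C c * powGen a v b) := by
  simp [shearHom]

theorem raises_shearHom {wt : Fin m ⊕ (Fin n ⊕ Fin n) → ℕ} {d : ℕ} (c : ℝ) (a : Fin m → ℕ) (b : ℕ)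
    (v : Phase n) (h : powGen a v b ∈ filtration wt (1 + d)) (hwt : ∀ j, wt (Sum.inr j) = 1) :
    Raises wt d (shearHom c a b v) := by
  rintro (i | j)
  · rw [shearHom_inl, sub_self]
    exact Submodule.zero_mem _
  · rw [shearHom_inr, add_sub_cancel_left, hwt]
    exact C_mul_mem_filtration _ (C_mul_mem_filtration _ h)

theorem powGen_mem_parWeight (a : Fin m → ℕ) (v : Phase n) (b : ℕ) :
    powGen a v b ∈ filtration parWeight (2 * ∑ i, a i + b) :=
  fun _ hs => ((powGen_homogeneous a v b).1 (mem_support_iff.1 hs)).ge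

theorem powGen_mem_one (a : Fin m → ℕ) (v : Phase n) (b : ℕ) :
    powGen a v b ∈ filtration (fun _ => 1) (∑ i, a i + b) := by
  intro s hs
  have h1 := (powGen_homogeneous a v b).1 (mem_support_iff.1 hs)
  have h2 := (powGen_homogeneous a v b).2 hs
  have h3 : ∀ i, s (Sum.inl i) = a i := by
    classical
    rw [powGen_eq_sum] at hs
    obtain ⟨k, _, hk⟩ := Finset.mem_biUnion.1 (support_sum hs)
    have := Finset.mem_singleton.1 (support_monomial_subset hk)
    intro i
    rw [this, expo_inl]
  rw [Set.mem_ofPred_eq, phaseWeight_eq] at h2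
  rw [Set.mem_ofPred_eq, oneWeight_eq]
  simp only [h3]
  omega

/-- Neither `extend v` nor its image under `symp` has q_0 or p_0 components, so the shear neither
moves nor sees these variables. The condition `hw` forces b ≥ 2 or a factor ε_i, which makes the map
the identity to first order at ε = 0. For r = 2, `hrb` excludes translations. -/
theorem PolyChange.shear {r : ℕ} (c : ℝ) (a : Fin m → ℕ) (b : ℕ) (v : Phase n)
    (hrb : r ≤ b + 1) (hw : 3 ≤ 2 * ∑ i, a i + (b + 1)) :
    PolyChange r (HamNF.shear (-c) a b (extend v)) (HamNF.shear c a b (extend v))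
      (shearHom c a b v) where
  smooth := contDiff_shear _ _ _ _
  smooth_inv := contDiff_shear _ _ _ _
  left_inv ε x := by simpa using shear_neg_shear (-c) a b (extend v) ε x
  right_inv ε x := shear_neg_shear c a b (extend v) ε x
  symplectic ε x := symplectic_shear _ _ _ _ _ _
  map_zero := by
    have h : (∏ i, (0 : Param m) i ^ a i) * dotCLM (extend v) 0 ^ b = 0 := by
      rcases Nat.eq_zero_or_pos (∑ i, a i) with h | h
      · rw [_root_.map_zero, zero_pow (by omega), mul_zero]
      · obtain ⟨i, hi, hi'⟩ := Finset.exists_ne_zero_of_sum_ne_zero h.ne'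
        rw [Finset.prod_eq_zero hi (by simp [hi']), zero_mul]
    simp only [HamNF.shear, mul_assoc, h, mul_zero, zero_smul, add_zero]
  hasFDerivAt_zero := by
    refine (hasFDerivAt_shear (-c) a b (extend v) 0 0).congr_fderiv ?_
    have h : (∏ i, (0 : Param m) i ^ a i) * (b * dotCLM (extend v) 0 ^ (b - 1)) = 0 := by
      rcases Nat.eq_zero_or_pos (∑ i, a i) with h | h
      · rw [_root_.map_zero, zero_pow (by omega), mul_zero, mul_zero]
      · obtain ⟨i, hi, hi'⟩ := Finset.exists_ne_zero_of_sum_ne_zero h.ne'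
        rw [Finset.prod_eq_zero hi (by simp [hi']), zero_mul]
    rw [mul_assoc, h, mul_zero, zero_smul, add_zero]
  q0 ε x := by simp [HamNF.shear, symp_extend]
  p0 ε x t := by
    have h : dotCLM (extend v) (Pi.single (Sum.inr 0) 1) = 0 := by
      rw [dotCLM_apply, dotProduct_single_one, extend_inr_zero]
    simp only [HamNF.shear, map_add, map_smul, h, smul_zero, add_zero]
    abel
  pullback ε z := by
    rw [HamNF.shear, symp_extend, extend_add_smul, dotCLM_extend, restrict_extend]
    congr 1
    ext j
    rw [shearHom_inr]
    simp only [Pi.add_apply, Pi.smul_apply, smul_eq_mul, map_add, map_mul, eval_X, eval_C,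
      Sum.elim_inr, eval_powGen]
    ring
  pullback_par i := shearHom_inl _ _ _ _ _
  raises_one := raises_shearHom c a b v (filtration_anti (by omega) (powGen_mem_one a v b))
    fun _ => rfl
  raises_phase h := raises_shearHom c a b v
    (filtration_anti (by omega) (powGen_homogeneous a v b).2) fun _ => rfl
  sub_isBigO h := by
    have h1 : (fun y : Param m × Phase n => eval (Sum.elim y.1 y.2) (powGen a v b)) =O[𝓝 0]
        fun y => ‖y.2‖ ^ 1 * ‖y‖ ^ 1 :=
      isBigO_eval (filtration_anti (by omega) (powGen_homogeneous a v b).2)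
        (filtration_anti (by omega) (powGen_mem_one a v b))
    have hc : Continuous (fun y : Param m × Phase (n + 1) => (y.1, restrict y.2)) := by
      refine continuous_fst.prodMk (continuous_pi fun j => ?_)
      exact (continuous_apply _).comp continuous_snd
    have ht : Tendsto (fun y : Param m × Phase (n + 1) => (y.1, restrict y.2)) (𝓝 0) (𝓝 0) :=
      hc.tendsto 0
    have h2 := (h1.comp_tendsto ht).const_mul_left (-c)
    have h4 : (fun y : Param m × Phase (n + 1) =>
        HamNF.shear (-c) a b (extend v) y.1 y.2 - y.2) =O[𝓝 0]
        fun y => ‖restrict y.2‖ * ‖(y.1, restrict y.2)‖ := by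
      refine IsBigO.congr_left (f₁ := fun y : Param m × Phase (n + 1) =>
        (-c * eval (Sum.elim y.1 (restrict y.2)) (powGen a v b)) • symp (extend v)) ?_ ?_
      · have h5 := h2.smul (isBigO_const_const (symp (extend v)) (one_ne_zero (α := ℝ))
          (𝓝 (0 : Param m × Phase (n + 1))))
        simpa [Function.comp_def] using h5
      · intro y
        rw [HamNF.shear, add_sub_cancel_left, eval_powGen, dotCLM_extend, mul_assoc]
    refine h4.trans (IsBigO.of_norm_le fun y => ?_)
    rw [norm_mul, norm_norm, norm_norm, mul_comm]
    refine mul_le_mul_of_nonneg_right ?_ (norm_nonneg _)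
    exact max_le_max le_rfl (norm_restrict_le_dropP0 _)

end ChangeOfVariables

/-! ### Splitting polynomials by exponents. -/

section Splitting

variable {τ : Type*}

/-- Splitting of a polynomial according to a property of the exponents. -/
theorem exists_split (A : Set (τ →₀ ℕ)) (p : MvPolynomial τ ℝ) :
    ∃ p₁ p₂ : MvPolynomial τ ℝ, p = p₁ + p₂ ∧
      p₁ ∈ restrictSupport ℝ ({s | s ∈ p.support} ∩ A) ∧
      p₂ ∈ restrictSupport ℝ ({s | s ∈ p.support} ∩ Aᶜ) := by
  classical
  refine ⟨∑ s ∈ p.support with s ∈ A, monomial s (coeff s p),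
    ∑ s ∈ p.support with s ∉ A, monomial s (coeff s p), ?_, ?_, ?_⟩
  · rw [Finset.sum_filter_add_sum_filter_not, ← p.as_sum]
  all_goals
    exact Submodule.sum_mem _ fun s hs => (monomial_mem_restrictSupport ℝ).2
      (Or.inl (Finset.mem_filter.1 hs))

theorem mem_restrictSupport_of_mem {A D : Set (τ →₀ ℕ)} {p p₁ : MvPolynomial τ ℝ}
    (hp : p ∈ restrictSupport ℝ D) (h : p₁ ∈ restrictSupport ℝ ({s | s ∈ p.support} ∩ A)) :
    p₁ ∈ restrictSupport ℝ D :=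
  fun _ hs => hp (h hs).1

end Splitting

/-! ### Quadratic forms and the effect of a shear on them. -/

section QuadraticForm

variable {m n : ℕ}

/-- The quadratic form with matrix `B` (divided by two) as a polynomial. -/
noncomputable def quadForm (B : Matrix (Fin n ⊕ Fin n) (Fin n ⊕ Fin n) ℝ) :
    MvPolynomial (Fin m ⊕ (Fin n ⊕ Fin n)) ℝ :=
  ∑ i, ∑ j, C (B i j / 2) * (X (Sum.inr i) * X (Sum.inr j))

/-- The matrix of the linear Hamiltonian vector field of a quadratic form. -/
def hamMat (B : Matrix (Fin n ⊕ Fin n) (Fin n ⊕ Fin n) ℝ) :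
    Matrix (Fin n ⊕ Fin n) (Fin n ⊕ Fin n) ℝ :=
  Matrix.of fun i j => symp (fun l => B l j) i

theorem quadForm_add (B B' : Matrix (Fin n ⊕ Fin n) (Fin n ⊕ Fin n) ℝ) :
    quadForm (m := m) (B + B') = quadForm B + quadForm B' := by
  simp only [quadForm, ← Finset.sum_add_distrib]
  refine Finset.sum_congr rfl fun i _ => Finset.sum_congr rfl fun j _ => ?_
  rw [Matrix.add_apply, add_div, C_add]
  ring

theorem quadForm_single (i j : Fin n ⊕ Fin n) (c : ℝ) :
    quadForm (m := m) (Matrix.single i j c) = C (c / 2) * (X (Sum.inr i) * X (Sum.inr j)) := by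
  rw [quadForm, Finset.sum_eq_single i, Finset.sum_eq_single j]
  · simp
  · intro b _ hb
    simp [hb.symm]
  · simp
  · intro b _ hb
    simp [hb.symm]
  · simp

theorem quadForm_mem_phase (B : Matrix (Fin n ⊕ Fin n) (Fin n ⊕ Fin n) ℝ) :
    quadForm (m := m) B ∈ filtration phaseWeight 2 :=
  Submodule.sum_mem _ fun i _ => Submodule.sum_mem _ fun j _ => C_mul_mem_filtration _
    (mul_mem_filtration (X_mem_filtration phaseWeight (Sum.inr i))
      (X_mem_filtration phaseWeight (Sum.inr j)))

theorem eval_quadForm (B : Matrix (Fin n ⊕ Fin n) (Fin n ⊕ Fin n) ℝ) (ε : Param m) (z : Phase n) :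
    eval (Sum.elim ε z) (quadForm B) = (1 / 2) * (z ⬝ᵥ B *ᵥ z) := by
  simp only [quadForm, map_sum, map_mul, eval_C, eval_X, Sum.elim_inr, dotProduct, Matrix.mulVec,
    Finset.mul_sum]
  refine Finset.sum_congr rfl fun i _ => Finset.sum_congr rfl fun j _ => ?_
  ring

/-- The weight 2 of the parameters is chosen for this: under the two degree conditions a monomial
containing a parameter has weight at least 3, so only products of two phase variables lie below. -/
theorem exists_quadForm {p : MvPolynomial (Fin m ⊕ (Fin n ⊕ Fin n)) ℝ}
    (h1 : p ∈ filtration (fun _ => 1) 2) (h2 : p ∈ filtration phaseWeight 1) :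
    ∃ B : Matrix (Fin n ⊕ Fin n) (Fin n ⊕ Fin n) ℝ, Bᵀ = B ∧
      p - quadForm B ∈ filtration parWeight 3 := by
  obtain ⟨p₁, p₂, rfl, hp₁, hp₂⟩ := exists_split {s | Finsupp.weight parWeight s < 3} p
  suffices h : ∃ B : Matrix (Fin n ⊕ Fin n) (Fin n ⊕ Fin n) ℝ, Bᵀ = B ∧ p₁ = quadForm B by
    obtain ⟨B, hB, hpB⟩ := h
    refine ⟨B, hB, ?_⟩
    rw [← hpB, add_sub_cancel_left]
    exact fun s hs => not_lt.1 (Set.notMem_ofPred_iff.1 (hp₂ hs).2)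
  rw [p₁.as_sum]
  refine Finset.sum_induction _ (fun q => ∃ B : Matrix (Fin n ⊕ Fin n) (Fin n ⊕ Fin n) ℝ,
    Bᵀ = B ∧ q = quadForm B) ?_ ?_ ?_
  · rintro _ _ ⟨B, hB, rfl⟩ ⟨B', hB', rfl⟩
    exact ⟨B + B', by rw [Matrix.transpose_add, hB, hB'], (quadForm_add B B').symm⟩
  · exact ⟨0, by simp, by simp [quadForm]⟩
  · intro s hs
    obtain ⟨hsp, hs3⟩ := hp₁ hs
    have hs1 := h1 hsp
    have hs2 := h2 hsp
    simp only [Set.mem_ofPred_eq, oneWeight_eq, phaseWeight_eq, parWeight_eq] at hs1 hs2 hs3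
    obtain ⟨i, -, hi⟩ := Finset.exists_ne_zero_of_sum_ne_zero
      (show ∑ j, s (Sum.inr j) ≠ 0 by omega)
    set s' := s - Finsupp.single (Sum.inr i) 1 with hs'
    have hss' : s = s' + Finsupp.single (Sum.inr i) 1 := by
      rw [hs', tsub_add_cancel_of_le]
      rw [Finsupp.single_le_iff]
      omega
    have e1 : ∑ j, s (Sum.inr j) = ∑ j, s' (Sum.inr j) + 1 := by
      rw [← phaseWeight_eq, ← phaseWeight_eq, ← weight_phase_add_single _ i, ← hss']
    obtain ⟨j, -, hj⟩ := Finset.exists_ne_zero_of_sum_ne_zero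
      (show ∑ j, s' (Sum.inr j) ≠ 0 by omega)
    set s'' := s' - Finsupp.single (Sum.inr j) 1 with hs''
    have hss'' : s' = s'' + Finsupp.single (Sum.inr j) 1 := by
      rw [hs'', tsub_add_cancel_of_le]
      rw [Finsupp.single_le_iff]
      omega
    have e2 : ∑ j, s' (Sum.inr j) = ∑ j, s'' (Sum.inr j) + 1 := by
      rw [← phaseWeight_eq, ← phaseWeight_eq, ← weight_phase_add_single _ j, ← hss'']
    have e3 : s'' = 0 := by
      have h0 : ∀ x, s'' x ≤ s x := fun x => (tsub_le_self.trans tsub_le_self : s'' ≤ s) x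
      ext (x | x)
      · have := Finset.single_le_sum (f := fun x => s (Sum.inl x)) (fun _ _ => Nat.zero_le _)
          (Finset.mem_univ x)
        have := h0 (Sum.inl x)
        simp only [Finsupp.coe_zero, Pi.zero_apply]
        omega
      · have := Finset.single_le_sum (f := fun x => s'' (Sum.inr x)) (fun _ _ => Nat.zero_le _)
          (Finset.mem_univ x)
        simp only [Finsupp.coe_zero, Pi.zero_apply]
        omega
    set c := coeff s p₁
    -- Since `quadForm` halves the entries, the two of them together give c z_i z_j, also when i =
    -- j.
    refine ⟨Matrix.single i j c + Matrix.single j i c, ?_, ?_⟩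
    · rw [Matrix.transpose_add, Matrix.transpose_single, Matrix.transpose_single, add_comm]
    · rw [quadForm_add, quadForm_single, quadForm_single, hss', hss'', e3, zero_add]
      have hm : monomial (Finsupp.single (Sum.inr j : Fin m ⊕ (Fin n ⊕ Fin n)) 1 +
          Finsupp.single (Sum.inr i) 1) c = C c * (X (Sum.inr j) * X (Sum.inr i)) := by
        rw [X, X, monomial_mul, C_mul_monomial, mul_one, mul_one]
      rw [hm, mul_comm (X (Sum.inr j)), ← add_mul, ← C_add, add_halves]

theorem pderiv_powGen (a : Fin m → ℕ) (v : Phase n) (b : ℕ) (i : Fin n ⊕ Fin n) :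
    pderiv (Sum.inr i) (powGen a v (b + 1)) = C (v i * (b + 1)) * powGen a v b := by
  have h0 : pderiv (R := ℝ) (Sum.inr i)
      (∏ i, (X (Sum.inl i) : MvPolynomial (Fin m ⊕ (Fin n ⊕ Fin n)) ℝ) ^ a i) = 0 := by
    have := monomial_expo (κ := Fin n ⊕ Fin n) a (fun _ => 0) 1
    simp only [map_one, pow_zero, Finset.prod_const_one, mul_one, one_mul] at this
    rw [← this, pderiv_monomial]
    simp
  have h1 : pderiv (R := ℝ) (Sum.inr i)
      (linForm v : MvPolynomial (Fin m ⊕ (Fin n ⊕ Fin n)) ℝ) = C (v i) := by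
    simp only [linForm, map_sum, Derivation.leibniz, pderiv_C, pderiv_X, smul_eq_mul, mul_zero,
      add_zero]
    rw [Finset.sum_eq_single i]
    · simp
    · intro j _ hj
      rw [Pi.single_eq_of_ne, mul_zero]
      simpa using hj
    · simp
  rw [powGen, Derivation.leibniz, h0, Derivation.leibniz_pow, h1, powGen]
  simp only [smul_eq_mul, nsmul_eq_mul, mul_zero, add_zero, Nat.add_sub_cancel, C_mul, C_add, C_1]
  push_cast
  simp only [map_natCast]
  ring

/-- The shear replaces z by z + T symp v with T = c(b+1) ε^a⟨v, z⟩^b. The terms linear in T are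
minus the derivative of the generator along the Hamiltonian field of the quadratic form. With w =
2|a| + b + 1 ≥ 3, the T² terms have weight at least 2(w − 1) ≥ w + 1. -/
theorem shearHom_quadForm {B : Matrix (Fin n ⊕ Fin n) (Fin n ⊕ Fin n) ℝ} (hB : Bᵀ = B) (c : ℝ)
    (a : Fin m → ℕ) (v : Phase n) (b : ℕ) (hw : 3 ≤ 2 * ∑ i, a i + (b + 1)) :
    shearHom (c * (b + 1)) a b v (quadForm B) - quadForm B +
        linVF (hamMat B) (c • powGen a v (b + 1)) ∈
      filtration parWeight (2 * ∑ i, a i + (b + 1) + 1) := by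
  set T : MvPolynomial (Fin m ⊕ (Fin n ⊕ Fin n)) ℝ := C (c * (b + 1)) * powGen a v b with hT
  have hTw : T ∈ filtration parWeight (2 * ∑ i, a i + b) :=
    C_mul_mem_filtration _ (powGen_mem_parWeight a v b)
  have hlin : linVF (hamMat B) (c • powGen a v (b + 1)) =
      -∑ i, ∑ j, C (B i j) * (C (symp v i) * X (Sum.inr j) * T) := by
    have h1 : ∀ i j, hamMat B i j • (X (Sum.inr j) * pderiv (Sum.inr i) (c • powGen a v (b + 1)))
        = C (hamMat B i j * v i) * (X (Sum.inr j) * T) := fun i j => by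
      rw [Derivation.map_smul, pderiv_powGen, hT, smul_eq_C_mul, smul_eq_C_mul]
      simp only [C_mul]
      ring
    have h2 : ∀ j, ∑ i, hamMat B i j * v i = -∑ i, B i j * symp v i := fun j =>
      symp_dotProduct (fun l => B l j) v
    rw [linVF_apply]
    simp only [h1]
    rw [Finset.sum_comm]
    simp only [← Finset.sum_mul, ← map_sum, h2]
    rw [Finset.sum_comm, ← Finset.sum_neg_distrib]
    refine Finset.sum_congr rfl fun j _ => ?_
    simp only [map_neg, map_sum, C_mul, neg_mul, Finset.sum_mul]
    congr 1
    exact Finset.sum_congr rfl fun i _ => by ring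
  have hquad : shearHom (c * (b + 1)) a b v (quadForm B) - quadForm B =
      ∑ i, ∑ j, C (B i j) * (C (symp v i) * X (Sum.inr j) * T) +
      ∑ i, ∑ j, C (B i j / 2 * (symp v i * symp v j)) * (T * T) := by
    have hC : ∀ x : ℝ, shearHom (c * (b + 1)) a b v (C x) = C x := fun x =>
      (shearHom (c * (b + 1)) a b v).commutes x
    have hsymm : ∑ i, ∑ j, C (B i j / 2) * (C (symp v j) * X (Sum.inr i) * T) =
        ∑ i, ∑ j, C (B i j / 2) * (C (symp v i) * X (Sum.inr j) * T) := by
      rw [Finset.sum_comm]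
      refine Finset.sum_congr rfl fun i _ => Finset.sum_congr rfl fun j _ => ?_
      have : B j i = B i j := congrFun (congrFun hB i) j
      rw [this]
    have hsplit : ∑ i, ∑ j, C (B i j) * (C (symp v i) * X (Sum.inr j) * T) =
        ∑ i, ∑ j, C (B i j / 2) * (C (symp v i) * X (Sum.inr j) * T) +
        ∑ i, ∑ j, C (B i j / 2) * (C (symp v j) * X (Sum.inr i) * T) := by
      rw [hsymm]
      simp only [← Finset.sum_add_distrib, ← add_mul, ← C_add, add_halves]
    rw [hsplit]
    simp only [quadForm, map_sum, map_mul (shearHom (c * (b + 1)) a b v), shearHom_inr, hC, ← hT,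
      ← Finset.sum_add_distrib, ← Finset.sum_sub_distrib]
    refine Finset.sum_congr rfl fun i _ => Finset.sum_congr rfl fun j _ => ?_
    simp only [C_mul]
    ring
  rw [hquad, hlin, add_neg_cancel_comm]
  refine Submodule.sum_mem _ fun i _ => Submodule.sum_mem _ fun j _ => C_mul_mem_filtration _ ?_
  exact filtration_anti (by omega) (mul_mem_filtration hTw hTw)

end QuadraticForm

/-! ### Normalisation of polynomial Hamiltonians. -/

section Normalisation

variable {m n : ℕ}

/-- Every generator of weight `w` in the span of the powers of linear forms is realised, to
leading order, by a polynomial canonical change of variables. -/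
theorem exists_polyChange_of_mem_span {B : Matrix (Fin n ⊕ Fin n) (Fin n ⊕ Fin n) ℝ} (hB : Bᵀ = B)
    {w r : ℕ} (hw : 3 ≤ w) (hr : 1 ≤ r) {S : MvPolynomial (Fin m ⊕ (Fin n ⊕ Fin n)) ℝ}
    (hS : S ∈ Submodule.span ℝ (powGenSet w r)) :
    ∃ (Φ Ψ : Param m → Phase (n + 1) → Phase (n + 1)) (θ : _ →ₐ[ℝ] _), PolyChange r Φ Ψ θ ∧
      Raises parWeight (w - 2) θ ∧
      θ (quadForm B) - quadForm B + linVF (hamMat B) S ∈ filtration parWeight (w + 1) := by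
  induction hS using Submodule.closure_induction with
  | zero => exact ⟨_, _, _, PolyChange.id r, Raises.id _ _, by simp⟩
  | add S₁ S₂ hS₁ hS₂ ih₁ ih₂ =>
    obtain ⟨Φ₁, Ψ₁, θ₁, h₁, hr₁, hq₁⟩ := ih₁
    obtain ⟨Φ₂, Ψ₂, θ₂, h₂, hr₂, hq₂⟩ := ih₂
    refine ⟨_, _, _, h₁.comp h₂, hr₁.comp hr₂, ?_⟩
    have hS₂w : linVF (hamMat B) S₂ ∈ filtration parWeight w := fun s hs =>
      (linVF_homogeneous _ (fun s hs => (span_powGenSet_le w r hS₂).1 (mem_support_iff.2 hs))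
        (mem_support_iff.1 hs)).ge
    -- Generators add to leading order: the interaction term is `θ₁` minus the identity on a
    -- polynomial of weight w, which gains at least w − 2 ≥ 1.
    have e : (θ₁.comp θ₂) (quadForm B) - quadForm B + linVF (hamMat B) (S₁ + S₂) =
        θ₁ (θ₂ (quadForm B) - quadForm B + linVF (hamMat B) S₂) +
        (θ₁ (quadForm B) - quadForm B + linVF (hamMat B) S₁) -
        (θ₁ (linVF (hamMat B) S₂) - linVF (hamMat B) S₂) := by
      simp only [AlgHom.comp_apply, map_add, map_sub]
      ring
    rw [e]
    exact Submodule.sub_mem _ (Submodule.add_mem _ (hr₁.map_mem hq₂) hq₁)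
      (filtration_anti (by omega) (hr₁.sub_mem hS₂w))
  | smul_mem c S hS =>
    obtain ⟨a, v, b, hrb, rfl, rfl⟩ := hS
    obtain ⟨b, rfl⟩ := Nat.exists_eq_add_of_le' (hr.trans hrb)
    -- The factor b + 1 comes from differentiating ⟨v, z⟩^(b+1).
    refine ⟨_, _, _, PolyChange.shear (c * (b + 1)) a b v hrb hw,
      raises_shearHom _ a b v ?_ fun _ => rfl, shearHom_quadForm hB c a v b hw⟩
    exact filtration_anti (by omega) (powGen_mem_parWeight a v b)

/-- Normalisation weight by weight. -/
theorem exists_normalise {B : Matrix (Fin n ⊕ Fin n) (Fin n ⊕ Fin n) ℝ} (hB : Bᵀ = B) {r : ℕ}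
    (hr : r = 1 ∨ r = 2) {p : MvPolynomial (Fin m ⊕ (Fin n ⊕ Fin n)) ℝ}
    (hp : p - quadForm B ∈ filtration parWeight 3) (hp2 : r = 2 → p ∈ filtration phaseWeight 2)
    (w : ℕ) : ∃ (Φ Ψ : Param m → Phase (n + 1) → Phase (n + 1)) (θ : _ →ₐ[ℝ] _)
      (N : MvPolynomial (Fin m ⊕ (Fin n ⊕ Fin n)) ℝ), PolyChange r Φ Ψ θ ∧
      N ∈ filtration parWeight 3 ∧ linVF (hamMat B)ᵀ N = 0 ∧
      θ p - quadForm B - N ∈ filtration parWeight (w + 3) ∧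
      (r = 2 → N ∈ filtration phaseWeight 2) := by
  induction w with
  | zero =>
    refine ⟨_, _, _, 0, PolyChange.id r, Submodule.zero_mem _, map_zero _, ?_,
      fun _ => Submodule.zero_mem _⟩
    simpa using hp
  | succ w ih =>
    obtain ⟨Φ, Ψ, θ, N, hθ, hN3, hNL, hR, hN2⟩ := ih
    set R := θ p - quadForm B - N with hRdef
    obtain ⟨F, R', hsplit, hF, hR'⟩ := exists_split {s | Finsupp.weight parWeight s = w + 3} R
    have hFw : IsWeightedHomogeneous parWeight F (w + 3) := fun s hs =>
      (hF (mem_support_iff.2 hs)).2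
    have hR'w : R' ∈ filtration parWeight (w + 3 + 1) := fun s hs => by
      have h1 := hR (hR' hs).1
      have h2 := (hR' hs).2
      simp only [Set.mem_compl_iff, Set.mem_ofPred_eq] at h1 h2 ⊢
      omega
    have hR2 : r = 2 → R ∈ filtration phaseWeight 2 := fun h =>
      Submodule.sub_mem _ (Submodule.sub_mem _ ((hθ.raises_phase h).map_mem (hp2 h))
        (quadForm_mem_phase B)) (hN2 h)
    have hF2 : r = 2 → F ∈ filtration phaseWeight 2 := fun h =>
      mem_restrictSupport_of_mem (hR2 h) hF
    obtain ⟨S, hS, hSL⟩ := exists_homological (hamMat B) (w + 3) r F hFw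
      (hr.imp id fun h => by subst h; exact hF2 rfl)
    obtain ⟨Φ', Ψ', θ', hθ', hraise, hq⟩ := exists_polyChange_of_mem_span hB (by omega)
      (by omega) hS
    have hS' := span_powGenSet_le _ _ hS
    have hLS : IsWeightedHomogeneous parWeight (linVF (hamMat B) S) (w + 3) :=
      linVF_homogeneous _ fun s hs => hS'.1 (mem_support_iff.2 hs)
    refine ⟨_, _, _, N + (F - linVF (hamMat B) S), hθ'.comp hθ, ?_, ?_, ?_, ?_⟩
    · refine Submodule.add_mem _ hN3 (Submodule.sub_mem _ ?_ ?_)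
      · exact fun s hs => by rw [Set.mem_ofPred_eq, hFw (mem_support_iff.1 hs)]; omega
      · exact fun s hs => by rw [Set.mem_ofPred_eq, hLS (mem_support_iff.1 hs)]; omega
    · rw [map_add, hNL, hSL, add_zero]
    -- All four summands have weight at least w + 4: the first by the choice of S, the next two
    -- because `θ'` gains w + 1 on N (weight 3) and on R (weight w + 3), the last because `R'` is R
    -- without its part of weight w + 3.
    · have e : (θ'.comp θ) p - quadForm B - (N + (F - linVF (hamMat B) S)) =
          (θ' (quadForm B) - quadForm B + linVF (hamMat B) S) + (θ' N - N) + (θ' R - R) + R' := by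
        have h1 : θ p = quadForm B + N + R := by rw [hRdef]; ring
        have h2 : R' = R - F := by rw [hsplit]; ring
        rw [AlgHom.comp_apply, h1, map_add, map_add, h2]
        ring
      rw [e]
      refine Submodule.add_mem _ (Submodule.add_mem _ (Submodule.add_mem _ ?_ ?_) ?_) ?_
      · exact filtration_anti (by omega) hq
      · exact filtration_anti (by omega) (hraise.sub_mem hN3)
      · exact filtration_anti (by omega) (hraise.sub_mem hR)
      · exact filtration_anti (by omega) hR'w
    · intro h
      subst h
      exact Submodule.add_mem _ (hN2 rfl) (Submodule.sub_mem _ (hF2 rfl) (linVF_mem_phase _ hS'.2))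

/-- Elphick normal form of a polynomial Hamiltonian. -/
theorem exists_polynomial_normalForm {B : Matrix (Fin n ⊕ Fin n) (Fin n ⊕ Fin n) ℝ} (hB : Bᵀ = B)
    {r : ℕ} (hr : r = 1 ∨ r = 2) {p : MvPolynomial (Fin m ⊕ (Fin n ⊕ Fin n)) ℝ}
    (hp : p - quadForm B ∈ filtration parWeight 3) (hp2 : r = 2 → p ∈ filtration phaseWeight 2)
    (k : ℕ) : ∃ (Φ Ψ : Param m → Phase (n + 1) → Phase (n + 1)) (θ : _ →ₐ[ℝ] _)
      (N : MvPolynomial (Fin m ⊕ (Fin n ⊕ Fin n)) ℝ), PolyChange r Φ Ψ θ ∧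
      N ∈ restrictSupport ℝ {s | Finsupp.weight (fun _ => 1) s < k + 2} ∧
      N ∈ filtration parWeight 3 ∧ linVF (hamMat B)ᵀ N = 0 ∧
      θ p - quadForm B - N ∈ filtration (fun _ => 1) (k + 2) ∧
      (r = 2 → N ∈ filtration phaseWeight 2 ∧
        θ p - quadForm B - N ∈ filtration phaseWeight 2) := by
  -- Weight at least 2k + 3 suffices: 2α + β ≥ 2k + 3 forces total degree α + β ≥ k + 2.
  obtain ⟨Φ, Ψ, θ, N, hθ, hN3, hNL, hR, hN2⟩ := exists_normalise hB hr hp hp2 (2 * k)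
  obtain ⟨N₁, N₂, hsplit, hN₁, hN₂⟩ :=
    exists_split {s | Finsupp.weight (fun _ => 1) s < k + 2} N
  have hN₁k : N₁ ∈ restrictSupport ℝ {s | Finsupp.weight (fun _ => 1) s < k + 2} :=
    fun s hs => (hN₁ hs).2
  have hN₂k : N₂ ∈ filtration (fun _ => 1) (k + 2) := fun s hs =>
    not_lt.1 (Set.notMem_ofPred_iff.1 (hN₂ hs).2)
  refine ⟨Φ, Ψ, θ, N₁, hθ, hN₁k, mem_restrictSupport_of_mem hN3 hN₁, ?_, ?_, fun h => ?_⟩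
  -- The derivative preserves total degree, so the parts of N of low and high degree are annihilated
  -- separately.
  · have h1 : linVF (hamMat B)ᵀ N₁ ∈
        restrictSupport ℝ {s | Finsupp.weight (fun _ => 1) s < k + 2} := by
      refine linVF_mem_restrictSupport _ (fun s i j h => ?_) hN₁k
      simpa only [Set.mem_ofPred_eq, weight_one_add_single] using h
    have h2 : linVF (hamMat B)ᵀ N₂ ∈ filtration (fun _ => 1) (k + 2) := by
      refine linVF_mem_restrictSupport _ (fun s i j h => ?_) hN₂k
      simpa only [Set.mem_ofPred_eq, weight_one_add_single] using h
    have h3 : linVF (hamMat B)ᵀ N₁ = -linVF (hamMat B)ᵀ N₂ := by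
      rw [hsplit, map_add] at hNL
      exact eq_neg_of_add_eq_zero_left hNL
    by_contra hne
    obtain ⟨s, hs⟩ := support_nonempty.2 hne
    have h4 := h1 hs
    rw [h3, support_neg] at hs
    exact absurd h4 (Set.notMem_ofPred_iff.2 (not_lt.2 (h2 hs)))
  · have e : θ p - quadForm B - N₁ = (θ p - quadForm B - N) + N₂ := by rw [hsplit]; ring
    rw [e]
    refine Submodule.add_mem _ (fun s hs => ?_) hN₂k
    have := hR hs
    rw [Set.mem_ofPred_eq, parWeight_eq] at this
    rw [Set.mem_ofPred_eq, oneWeight_eq]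
    omega
  · have h1 : N₁ ∈ filtration phaseWeight 2 := mem_restrictSupport_of_mem (hN2 h) hN₁
    exact ⟨h1, Submodule.sub_mem _ (Submodule.sub_mem _ ((hθ.raises_phase h).map_mem (hp2 h))
        (quadForm_mem_phase B)) h1⟩

end Normalisation

/-! ### Recognising the quadratic part from an approximation. -/

section Hessian

variable {E : Type*} [NormedAddCommGroup E] [NormedSpace ℝ E]

/-- Second-order Taylor expansion at a critical point. -/
theorem isLittleO_sub_hessian {f : E → ℝ} (hf : ContDiffAt ℝ 2 f 0) (h0 : fderiv ℝ f 0 = 0) :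
    (fun y => f y - f 0 - (1 / 2) * fderiv ℝ (fderiv ℝ f) 0 y y) =o[𝓝 0] fun y => ‖y‖ ^ 2 := by
  set A := fderiv ℝ (fderiv ℝ f) 0 with hA
  have hsymm : ∀ u v, A u v = A v u := fun u v => hf.isSymmSndFDerivAt (by simp) u v
  have hdf : HasFDerivAt (fderiv ℝ f) A 0 :=
    ((hf.fderiv_right (m := 1) (by norm_num)).differentiableAt (by norm_num)).hasFDerivAt
  have hd : ∀ᶠ y in 𝓝 (0 : E), DifferentiableAt ℝ f y :=
    (hf.eventually (by simp)).mono fun y hy => hy.differentiableAt (by norm_num)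
  have hlo := hdf.isLittleO
  simp only [h0, sub_zero] at hlo
  refine IsLittleO.of_bound fun c hc => ?_
  obtain ⟨δ, hδ, hball⟩ := Metric.eventually_nhds_iff_ball.1 (hd.and (hlo.def hc))
  filter_upwards [Metric.ball_mem_nhds (0 : E) hδ] with y hy
  rw [mem_ball_zero_iff] at hy
  -- By symmetry of A the derivative of ½ A(y, y) is A y, which approximates that of f to first
  -- order; the mean value inequality on the ball of radius ‖y‖ supplies the second power.
  have hder : ∀ x ∈ Metric.closedBall (0 : E) ‖y‖,
      HasFDerivWithinAt (fun y => f y - f 0 - (1 / 2) * A y y) (fderiv ℝ f x - A x)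
        (Metric.closedBall (0 : E) ‖y‖) x := fun x hx => by
    have hx' : x ∈ Metric.ball (0 : E) δ := by
      rw [mem_closedBall_zero_iff] at hx
      rw [mem_ball_zero_iff]
      exact hx.trans_lt hy
    have h1 := (hball x hx').1.hasFDerivAt.sub_const (f 0)
    have h2 := (A.hasFDerivAt.clm_apply (hasFDerivAt_id x)).const_mul (1 / 2 : ℝ)
    refine ((h1.sub h2).congr_fderiv ?_).hasFDerivWithinAt
    ext v
    simp [hsymm v x]
    ring
  have hb : ∀ x ∈ Metric.closedBall (0 : E) ‖y‖, ‖fderiv ℝ f x - A x‖ ≤ c * ‖y‖ := fun x hx => by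
    rw [mem_closedBall_zero_iff] at hx
    exact ((hball x (mem_ball_zero_iff.2 (hx.trans_lt hy))).2).trans
      (mul_le_mul_of_nonneg_left hx hc.le)
  have := (convex_closedBall (0 : E) ‖y‖).norm_image_sub_le_of_norm_hasFDerivWithin_le hder hb
    (x := 0) (y := y) (by simp) (by simp)
  simpa [pow_two, mul_assoc] using this

/-- A quadratic form approximating a function to third order is its quadratic part. -/
theorem hessian_of_isBigO {f q : E → ℝ} (hf : ContDiffAt ℝ 2 f 0)
    (hq : ∀ (t : ℝ) z, q (t • z) = t ^ 2 * q z) (hqO : q =O[𝓝 0] fun z => ‖z‖ ^ 2)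
    (h : (fun z => f z - q z) =O[𝓝 0] fun z => ‖z‖ ^ 3) (z : E) :
    fderiv ℝ (fderiv ℝ f) 0 z z = 2 * q z := by
  have h32 : (fun z : E => ‖z‖ ^ 3) =o[𝓝 0] fun z => ‖z‖ ^ 2 :=
    (isLittleO_pow_pow (𝕜 := ℝ) (m := 2) (n := 3) (by norm_num)).comp_tendsto tendsto_norm_zero
  have hf2 : f =O[𝓝 0] fun z => ‖z‖ ^ 2 := by
    simpa using (h.trans h32.isBigO).add hqO
  have hf2' : f =O[𝓝 0] fun z => ‖z - 0‖ ^ 2 := by simpa using hf2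
  have hf0 : f 0 = 0 := hf2'.eq_zero_of_norm_pow two_ne_zero
  have hdf0 : fderiv ℝ f 0 = 0 := (hf2'.hasFDerivAt one_lt_two).fderiv
  have hlo := (isLittleO_sub_hessian hf hdf0).sub (h.trans_isLittleO h32)
  set A := fderiv ℝ (fderiv ℝ f) 0 with hA
  have hd : (fun y => q y - (1 / 2) * A y y) =o[𝓝 0] fun y => ‖y‖ ^ 2 := by
    refine hlo.congr_left fun y => ?_
    rw [hf0]; ring
  by_contra hne
  have hne' : q z - (1 / 2) * A z z ≠ 0 := fun h => hne (by linarith)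
  set d := q z - (1 / 2) * A z z with hdz
  -- Homogeneity along t z gives ‖d‖ ≤ c ‖z‖² for every c > 0; this c yields ‖d‖ ≤ ‖d‖ / 2, and the
  -- + 1 covers z = 0.
  have hpos : 0 < ‖d‖ / (2 * (‖z‖ ^ 2 + 1)) := by positivity
  have ht : Tendsto (fun t : ℝ => t • z) (𝓝[≠] 0) (𝓝 0) := by
    have : Tendsto (fun t : ℝ => t • z) (𝓝 0) (𝓝 ((0 : ℝ) • z)) :=
      (continuous_id.smul continuous_const).tendsto 0
    rw [zero_smul] at this
    exact this.mono_left nhdsWithin_le_nhds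
  obtain ⟨t, hbt, ht0⟩ := ((ht.eventually (hd.def hpos)).and self_mem_nhdsWithin).exists
  have ht0' : 0 < t ^ 2 := by
    have : t ≠ 0 := ht0
    positivity
  have e : q (t • z) - (1 / 2) * A (t • z) (t • z) = t ^ 2 * d := by
    rw [hq, hdz]
    simp
    ring
  rw [e, norm_mul, Real.norm_of_nonneg ht0'.le, norm_pow, norm_norm, norm_smul, mul_pow,
    Real.norm_eq_abs t, sq_abs] at hbt
  have h1 : ‖d‖ ≤ ‖d‖ / (2 * (‖z‖ ^ 2 + 1)) * ‖z‖ ^ 2 := by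
    refine le_of_mul_le_mul_left (hbt.trans_eq ?_) ht0'
    ring
  have hdpos : 0 < ‖d‖ := norm_pos_iff.2 hne'
  rw [div_mul_eq_mul_div, le_div_iff₀ (by positivity)] at h1
  nlinarith [sq_nonneg ‖z‖]

end Hessian

/-! ### The linearised vector field and Elphick's condition. -/

section Linearisation

variable {n : ℕ}

theorem quadForm_symm_polar {B : Matrix (Fin n ⊕ Fin n) (Fin n ⊕ Fin n) ℝ} (hB : Bᵀ = B)
    (u v : Phase n) : v ⬝ᵥ B *ᵥ u = u ⬝ᵥ B *ᵥ v := by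
  rw [Matrix.dotProduct_mulVec, ← Matrix.mulVec_transpose, hB, dotProduct_comm]

theorem hessian_polar {B : Matrix (Fin n ⊕ Fin n) (Fin n ⊕ Fin n) ℝ} (hB : Bᵀ = B)
    {K : Phase n → ℝ} (hK : ContDiffAt ℝ 2 K 0)
    (h : ∀ z, fderiv ℝ (fderiv ℝ K) 0 z z = z ⬝ᵥ B *ᵥ z) (u v : Phase n) :
    fderiv ℝ (fderiv ℝ K) 0 u v = u ⬝ᵥ B *ᵥ v := by
  have hsymm : fderiv ℝ (fderiv ℝ K) 0 u v = fderiv ℝ (fderiv ℝ K) 0 v u :=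
    hK.isSymmSndFDerivAt (by simp) u v
  have h1 := h (u + v)
  simp only [map_add, add_apply, Matrix.mulVec_add, dotProduct_add, add_dotProduct] at h1
  have h2 := h u
  have h3 := h v
  have h4 := quadForm_symm_polar hB u v
  linarith

/-- Polarisation recovers the whole Hessian, which identifies the matrix in the homological equation
with the L of the normal form. -/
theorem linearisation_eq_hamMat {B : Matrix (Fin n ⊕ Fin n) (Fin n ⊕ Fin n) ℝ} (hB : Bᵀ = B)
    {K : Phase n → ℝ} (hK : ContDiffAt ℝ 2 K 0)
    (h : ∀ z, fderiv ℝ (fderiv ℝ K) 0 z z = z ⬝ᵥ B *ᵥ z) : linearisation K = hamMat B := by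
  have hdf : HasFDerivAt (fderiv ℝ K) (fderiv ℝ (fderiv ℝ K) 0) 0 :=
    ((hK.fderiv_right (m := 1) (by norm_num)).differentiableAt (by norm_num)).hasFDerivAt
  have hp : ∀ l, HasFDerivAt (fun x => partialD K l x)
      ((ContinuousLinearMap.apply ℝ ℝ (Pi.single l 1 : Phase n)).comp
        (fderiv ℝ (fderiv ℝ K) 0)) 0 := fun l =>
    (ContinuousLinearMap.apply ℝ ℝ (Pi.single l 1 : Phase n)).hasFDerivAt.comp 0 hdf
  have hB' : ∀ l j, B j l = B l j := fun l j => congrFun (congrFun hB l) j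
  have hval : ∀ l j, fderiv ℝ (fderiv ℝ K) 0 (Pi.single j 1) (Pi.single l 1) = B l j :=
    fun l j => by
    rw [hessian_polar hB hK h, Matrix.mulVec_single_one, single_one_dotProduct]
    exact hB' l j
  have hV : HasFDerivAt (hamVF K) (ContinuousLinearMap.pi fun i => Sum.elim
      (fun i => (ContinuousLinearMap.apply ℝ ℝ (Pi.single (Sum.inr i) 1 : Phase n)).comp
        (fderiv ℝ (fderiv ℝ K) 0))
      (fun i => -(ContinuousLinearMap.apply ℝ ℝ (Pi.single (Sum.inl i) 1 : Phase n)).comp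
        (fderiv ℝ (fderiv ℝ K) 0)) i) 0 := by
    rw [hasFDerivAt_pi]
    rintro (i | i)
    · exact hp (Sum.inr i)
    · exact (hp (Sum.inl i)).neg
  ext i j
  rw [linearisation, hV.fderiv, LinearMap.toMatrix'_apply]
  rcases i with i | i <;> simp [hamMat, symp, hval]

theorem hasFDerivAt_eval {m : ℕ} (p : MvPolynomial (Fin m ⊕ (Fin n ⊕ Fin n)) ℝ) (ε : Param m)
    (z : Phase n) : HasFDerivAt (fun z : Phase n => eval (Sum.elim ε z) p)
      (∑ i, eval (Sum.elim ε z) (pderiv (Sum.inr i) p) •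
        (ContinuousLinearMap.proj i : Phase n →L[ℝ] ℝ)) z := by
  induction p using MvPolynomial.induction_on with
  | C c => simpa using hasFDerivAt_const c z
  | add p q hp hq =>
    simp only [map_add, add_smul, Finset.sum_add_distrib]
    exact hp.add hq
  | mul_X p i hp =>
    have hX : HasFDerivAt (fun z : Phase n => Sum.elim ε z i)
        (∑ j, (Pi.single (M := fun _ => ℝ) i (1 : ℝ) (Sum.inr j) : ℝ) •
          (ContinuousLinearMap.proj j : Phase n →L[ℝ] ℝ)) z := by
      rcases i with i | i
      · simpa using hasFDerivAt_const (ε i) z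
      · have : (∑ j, (Pi.single (M := fun _ => ℝ) (Sum.inr i : Fin m ⊕ (Fin n ⊕ Fin n)) (1 : ℝ)
            (Sum.inr j) : ℝ) • (ContinuousLinearMap.proj j : Phase n →L[ℝ] ℝ)) =
            ContinuousLinearMap.proj i := by
          rw [Finset.sum_eq_single i]
          · simp
          · intro j _ hj
            rw [Pi.single_eq_of_ne (by simpa using hj), zero_smul]
          · simp
        rw [this]
        exact (ContinuousLinearMap.proj (R := ℝ) (φ := fun _ => ℝ) i).hasFDerivAt
    have h := hp.mul hX
    simp only [map_mul, eval_X]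
    refine h.congr_fderiv ?_
    simp only [Finset.smul_sum, smul_smul, ← Finset.sum_add_distrib, ← add_smul,
      Derivation.leibniz, pderiv_X, smul_eq_mul, map_add, map_mul, eval_X]
    refine Finset.sum_congr rfl fun j _ => ?_
    congr 3
    by_cases hij : i = Sum.inr j
    · subst hij
      simp
    · rw [Pi.single_eq_of_ne (Ne.symm hij), Pi.single_eq_of_ne hij]
      simp

theorem elphickInvariant_of_linVF {m : ℕ} {L : Matrix (Fin n ⊕ Fin n) (Fin n ⊕ Fin n) ℝ}
    {P : MvPolynomial (Fin m ⊕ (Fin n ⊕ Fin n)) ℝ} (h : linVF Lᵀ P = 0) :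
    ElphickInvariant L P := by
  intro ε z
  have h1 : fderiv ℝ (evalAt P ε) z = _ := (hasFDerivAt_eval P ε z).fderiv
  rw [h1]
  have h2 := congrArg (eval (Sum.elim ε z)) h
  rw [linVF_apply] at h2
  simp only [map_sum, smul_eval, map_mul, eval_X, Sum.elim_inr, map_zero] at h2
  rw [← h2]
  simp only [sum_apply, smul_apply, ContinuousLinearMap.proj_apply,
    smul_eq_mul, Matrix.mulVec, dotProduct, Finset.mul_sum]
  exact Finset.sum_congr rfl fun i _ => Finset.sum_congr rfl fun j _ => by ring

end Linearisation

/-! ### Bounds at ε = 0 and comparison of norms. -/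

section PolynomialBounds

variable {m n : ℕ}

/-- At ε = 0 only parameter-free monomials survive, and their weight is their z-degree. -/
theorem isBigO_eval_par_zero {p : MvPolynomial (Fin m ⊕ (Fin n ⊕ Fin n)) ℝ}
    (hp : p ∈ filtration parWeight 3) :
    (fun z : Phase n => eval (Sum.elim (0 : Param m) z) p) =O[𝓝 0] fun z => ‖z‖ ^ 3 := by
  have h : (fun z : Phase n => eval (Sum.elim (0 : Param m) z) p) = fun z =>
      ∑ s ∈ p.support, eval (Sum.elim (0 : Param m) z) (monomial s (coeff s p)) := by
    ext y
    conv_lhs => rw [p.as_sum]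
    rw [map_sum]
  rw [h]
  refine IsBigO.fun_sum fun s hs => ?_
  refine IsBigO.of_bound ‖coeff s p‖ ?_
  have hw := hp hs
  rw [Set.mem_ofPred_eq, parWeight_eq] at hw
  filter_upwards [Metric.ball_mem_nhds (0 : Phase n) one_pos] with z hz
  rw [mem_ball_zero_iff] at hz
  refine (norm_eval_monomial_le s _ 0 z).trans (mul_le_mul_of_nonneg_left ?_ (norm_nonneg _))
  rw [norm_pow, norm_norm, norm_zero]
  rcases Nat.eq_zero_or_pos (∑ i, s (Sum.inl i)) with h0 | h0
  · rw [h0, pow_zero, one_mul]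
    exact pow_le_pow_of_le_one (norm_nonneg _) hz.le (by omega)
  · rw [zero_pow h0.ne', zero_mul]
    positivity

theorem norm_elim (ε : Param m) (z : Phase n) : ‖(Sum.elim ε z : _ → ℝ)‖ = ‖(ε, z)‖ := by
  apply le_antisymm
  · refine (pi_norm_le_iff_of_nonneg (norm_nonneg _)).2 ?_
    rintro (i | j)
    · exact (norm_le_pi_norm ε i).trans (norm_fst_le (ε, z))
    · exact (norm_le_pi_norm z j).trans (norm_snd_le (ε, z))
  · refine max_le ?_ ?_ <;> refine (pi_norm_le_iff_of_nonneg (norm_nonneg _)).2 fun i => ?_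
    · exact norm_le_pi_norm (Sum.elim ε z : _ → ℝ) (Sum.inl i)
    · exact norm_le_pi_norm (Sum.elim ε z : _ → ℝ) (Sum.inr i)

end PolynomialBounds

/-! ### Transfer from polynomials to the given Hamiltonian. -/

section Assembly

variable {m n : ℕ}

theorem PolyChange.map_zero_inv {r : ℕ} {Φ Ψ : Param m → Phase (n + 1) → Phase (n + 1)}
    {θ : MvPolynomial (Fin m ⊕ (Fin n ⊕ Fin n)) ℝ →ₐ[ℝ] MvPolynomial (Fin m ⊕ (Fin n ⊕ Fin n)) ℝ}
    (h : PolyChange r Φ Ψ θ) : Ψ 0 0 = 0 := by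
  have := h.left_inv 0 0
  rwa [h.map_zero] at this

theorem PolyChange.isCanonicalChange {r : ℕ} {Φ Ψ : Param m → Phase (n + 1) → Phase (n + 1)}
    {θ : MvPolynomial (Fin m ⊕ (Fin n ⊕ Fin n)) ℝ →ₐ[ℝ] MvPolynomial (Fin m ⊕ (Fin n ⊕ Fin n)) ℝ}
    (h : PolyChange r Φ Ψ θ) : IsCanonicalChange Φ Ψ where
  smooth := Eventually.of_forall fun _ => h.smooth.contDiffAt
  smooth_inv := Eventually.of_forall fun _ => h.smooth_inv.contDiffAt
  left_inv := Eventually.of_forall fun _ => h.left_inv _ _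
  right_inv := Eventually.of_forall fun _ => h.right_inv _ _
  symplectic := Eventually.of_forall fun _ => h.symplectic _ _

theorem PolyChange.tendsto_inv {r : ℕ} {Φ Ψ : Param m → Phase (n + 1) → Phase (n + 1)}
    {θ : MvPolynomial (Fin m ⊕ (Fin n ⊕ Fin n)) ℝ →ₐ[ℝ] MvPolynomial (Fin m ⊕ (Fin n ⊕ Fin n)) ℝ}
    (h : PolyChange r Φ Ψ θ) :
    Tendsto (fun y : Param m × Phase (n + 1) => (y.1, Ψ y.1 y.2)) (𝓝 0) (𝓝 0) := by
  have hc : Continuous (fun y : Param m × Phase (n + 1) => (y.1, Ψ y.1 y.2)) :=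
    continuous_fst.prodMk h.smooth_inv.continuous
  have := hc.tendsto 0
  simp only [Prod.fst_zero, Prod.snd_zero, h.map_zero_inv] at this
  exact this

/-- Since Ψ commutes with translations in p_0, its derivative fixes the p_0 direction, and the chain
rule carries cyclicity over. -/
theorem PolyChange.isCyclicP0 {r : ℕ} {Φ Ψ : Param m → Phase (n + 1) → Phase (n + 1)}
    {θ : MvPolynomial (Fin m ⊕ (Fin n ⊕ Fin n)) ℝ →ₐ[ℝ] MvPolynomial (Fin m ⊕ (Fin n ⊕ Fin n)) ℝ}
    (h : PolyChange r Φ Ψ θ) {H : Param m → Phase (n + 1) → ℝ} (hcyc : IsCyclicP0 H)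
    (hd : ∀ᶠ y in 𝓝 0, DifferentiableAt ℝ (Function.uncurry H) y) :
    IsCyclicP0 fun ε X => H ε (Ψ ε X) := by
  filter_upwards [h.tendsto_inv.eventually hcyc, h.tendsto_inv.eventually hd] with y hy hdy
  have hdH : DifferentiableAt ℝ (H y.1) (Ψ y.1 y.2) :=
    DifferentiableAt.comp (g := Function.uncurry H) (f := fun x => (y.1, x)) (Ψ y.1 y.2) hdy
      ((differentiableAt_const _).prodMk differentiableAt_id)
  have hdΨ : DifferentiableAt ℝ (Ψ y.1) y.2 :=
    ((h.smooth_inv.comp (contDiff_const.prodMk contDiff_id)).differentiable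
      (by simp)).differentiableAt
  have hline : fderiv ℝ (Ψ y.1) y.2 (Pi.single (Sum.inr 0) 1) = Pi.single (Sum.inr 0) 1 := by
    have h1 : HasDerivAt (fun t : ℝ => Ψ y.1 (y.2 + t • Pi.single (Sum.inr 0) 1))
        (fderiv ℝ (Ψ y.1) y.2 (Pi.single (Sum.inr 0) 1)) 0 :=
      hdΨ.hasFDerivAt.hasLineDerivAt _
    simp only [h.p0] at h1
    have h2 : HasDerivAt (fun t : ℝ => Ψ y.1 y.2 + t • (Pi.single (Sum.inr 0) 1 : Phase (n + 1)))
        (Pi.single (Sum.inr 0) 1) 0 := by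
      simpa using ((hasDerivAt_id (0 : ℝ)).smul_const
        (Pi.single (Sum.inr 0) 1 : Phase (n + 1))).const_add (Ψ y.1 y.2)
    exact h1.unique h2
  have hcomp : fderiv ℝ (fun X => H y.1 (Ψ y.1 X)) y.2 =
      (fderiv ℝ (H y.1) (Ψ y.1 y.2)).comp (fderiv ℝ (Ψ y.1) y.2) := fderiv_comp y.2 hdH hdΨ
  rw [partialD, hcomp, ContinuousLinearMap.comp_apply, hline]
  exact hy

/-- The lower-order Hamiltonian as a function of all its variables jointly. -/
def jointLower (H : Param m → Phase (n + 1) → ℝ) (y : Fin m ⊕ (Fin n ⊕ Fin n) → ℝ) : ℝ :=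
  H (fun i => y (Sum.inl i)) (extend fun j => y (Sum.inr j))

/-- The embedding of the lower-order variables. -/
def embed (y : Fin m ⊕ (Fin n ⊕ Fin n) → ℝ) : Param m × Phase (n + 1) :=
  (fun i => y (Sum.inl i), extend fun j => y (Sum.inr j))

theorem contDiff_extend : ContDiff ℝ ∞ (extend : Phase n → Phase (n + 1)) := by
  rw [contDiff_pi]
  rintro (i | i) <;> refine Fin.cases ?_ (fun i => ?_) i <;>
    simp only [extend_inl_zero, extend_inr_zero, extend_inl_succ, extend_inr_succ] <;> fun_prop

theorem contDiff_embed :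
    ContDiff ℝ ∞ (embed : (Fin m ⊕ (Fin n ⊕ Fin n) → ℝ) → Param m × Phase (n + 1)) :=
  ContDiff.prodMk (by fun_prop) (contDiff_extend.comp (by fun_prop))

theorem embed_zero : embed (0 : Fin m ⊕ (Fin n ⊕ Fin n) → ℝ) = 0 :=
  Prod.ext rfl extend_zero

theorem tendsto_embed :
    Tendsto (embed : (Fin m ⊕ (Fin n ⊕ Fin n) → ℝ) → Param m × Phase (n + 1)) (𝓝 0) (𝓝 0) := by
  have := (contDiff_embed (m := m) (n := n)).continuous.tendsto 0
  rwa [embed_zero] at this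

theorem contDiffAt_jointLower {H : Param m → Phase (n + 1) → ℝ} {k : ℕ}
    (hH : ContDiffAt ℝ (k : WithTop ℕ∞) (Function.uncurry H) 0) :
    ContDiffAt ℝ (k : WithTop ℕ∞) (jointLower H) 0 := by
  have h1 : ContDiffAt ℝ (k : WithTop ℕ∞) (Function.uncurry H)
      (embed (0 : Fin m ⊕ (Fin n ⊕ Fin n) → ℝ)) := by rwa [embed_zero]
  exact h1.comp 0 (contDiff_embed.contDiffAt.of_le (by exact_mod_cast le_top))

theorem norm_dropP0_extend_le (z : Phase n) : ‖dropP0 (extend z)‖ ≤ ‖z‖ := by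
  refine (norm_dropP0_le _).trans ((pi_norm_le_iff_of_nonneg (norm_nonneg _)).2 ?_)
  rintro (i | i) <;> refine Fin.cases ?_ (fun i => ?_) i
  · simp
  · exact norm_le_pi_norm z (Sum.inl i)
  · simp
  · exact norm_le_pi_norm z (Sum.inr i)

theorem elim_self (y : Fin m ⊕ (Fin n ⊕ Fin n) → ℝ) :
    (Sum.elim (fun i => y (Sum.inl i)) fun j => y (Sum.inr j) : _ → ℝ) = y := by
  ext (i | i) <;> rfl

theorem jointLower_isBigO {H : Param m → Phase (n + 1) → ℝ}
    (hH : (fun y : Param m × Phase (n + 1) => H y.1 y.2) =O[𝓝 0]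
      fun y => ‖(y.1, dropP0 y.2)‖ * ‖dropP0 y.2‖) :
    jointLower H =O[𝓝 0] fun y : Fin m ⊕ (Fin n ⊕ Fin n) → ℝ =>
      ‖y‖ * ‖fun j => y (Sum.inr j)‖ := by
  refine (hH.comp_tendsto tendsto_embed).trans (IsBigO.of_norm_le fun y => ?_)
  have h1 := norm_dropP0_extend_le fun j => y (Sum.inr j)
  have h2 : ‖(fun i => y (Sum.inl i), dropP0 (extend fun j => y (Sum.inr j)))‖ ≤ ‖y‖ := by
    rw [← elim_self y, norm_elim]
    exact max_le_max le_rfl h1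
  simp only [Function.comp_apply, embed, norm_mul, norm_norm]
  gcongr

theorem rayPt_phaseVars_zero (y : Fin m ⊕ (Fin n ⊕ Fin n) → ℝ) :
    rayPt phaseVars 0 y = Sum.elim (fun i => y (Sum.inl i)) 0 := by
  ext (i | i) <;> simp [rayPt, phaseVars]

theorem fderiv_jointLower {H : Param m → Phase (n + 1) → ℝ} {ε : Param m}
    (hd : DifferentiableAt ℝ (jointLower H) (Sum.elim ε (0 : Phase n))) (j : Fin n ⊕ Fin n) :
    fderiv ℝ (jointLower H) (Sum.elim ε (0 : Phase n)) (Pi.single (Sum.inr j) 1) =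
      partialD (lowerOrder H ε) j 0 := by
  let ι : Phase n →L[ℝ] (Fin m ⊕ (Fin n ⊕ Fin n) → ℝ) :=
    ContinuousLinearMap.pi (Sum.elim (fun _ => 0) fun j => ContinuousLinearMap.proj j)
  have hι : HasFDerivAt (fun z : Phase n => (Sum.elim ε z : Fin m ⊕ (Fin n ⊕ Fin n) → ℝ)) ι 0 := by
    rw [hasFDerivAt_pi']
    rintro (i | i)
    · exact (hasFDerivAt_const (ε i) _).congr_fderiv (by ext; simp [ι])
    · exact ((ContinuousLinearMap.proj (R := ℝ) (φ := fun _ => ℝ) i).hasFDerivAt).congr_fderiv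
        (by ext; simp [ι])
  have h1 : HasFDerivAt (lowerOrder H ε)
      ((fderiv ℝ (jointLower H) (Sum.elim ε (0 : Phase n))).comp ι) 0 :=
    hd.hasFDerivAt.comp 0 hι
  rw [partialD, h1.fderiv, ContinuousLinearMap.comp_apply]
  congr 1
  ext (i | i)
  · simp [ι]
  · simp [ι, Pi.single_apply]

/-- Taylor polynomial of the lower-order Hamiltonian. -/
theorem exists_taylor_lowerOrder {H : Param m → Phase (n + 1) → ℝ} {k r : ℕ} (hr : r = 1 ∨ r = 2)
    (hsmooth : ContDiffAt ℝ ((k + 2 : ℕ) : WithTop ℕ∞) (Function.uncurry H) 0)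
    (hH : (fun y : Param m × Phase (n + 1) => H y.1 y.2) =O[𝓝 0]
      fun y => ‖(y.1, dropP0 y.2)‖ * ‖dropP0 y.2‖)
    (heq : r = 2 → ∀ᶠ ε : Param m in 𝓝 0, hamVF (lowerOrder H ε) 0 = 0) :
    ∃ p : MvPolynomial (Fin m ⊕ (Fin n ⊕ Fin n)) ℝ,
      p ∈ filtration (fun _ => 1) 2 ∧ p ∈ filtration phaseWeight r ∧
      (fun y => jointLower H y - eval y p) =O[𝓝 0]
        fun y => ‖fun j => y (Sum.inr j)‖ ^ r * ‖y‖ ^ (k + 2 - r) := by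
  have hc := contDiffAt_jointLower hsmooth
  have hO := jointLower_isBigO hH
  have hray : Tendsto (fun y : Fin m ⊕ (Fin n ⊕ Fin n) → ℝ => rayPt phaseVars 0 y)
      (𝓝 0) (𝓝 0) := by
    refine squeeze_zero_norm (fun y => norm_rayPt_le _ (by simp) y) ?_
    exact tendsto_norm_zero
  -- At q_0 = 0 and z = 0 the factor |(q_0, q, p)| of the assumed bound vanishes, for every small ε.
  have h0 : ∀ᶠ y in 𝓝 0, jointLower H (rayPt phaseVars 0 y) = 0 := by
    obtain ⟨c, hc⟩ := hO.bound
    filter_upwards [hray.eventually hc] with y hy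
    have : (fun j => rayPt phaseVars 0 y (Sum.inr j)) = 0 := by
      rw [rayPt_phaseVars_zero]; rfl
    rw [this] at hy
    simpa using hy
  have hO2 : jointLower H =O[𝓝 0] fun y : Fin m ⊕ (Fin n ⊕ Fin n) → ℝ => ‖y - 0‖ ^ 2 := by
    refine hO.trans (IsBigO.of_norm_le fun y => ?_)
    rw [norm_mul, norm_norm, norm_norm, sub_zero, pow_two]
    gcongr
    exact (pi_norm_le_iff_of_nonneg (norm_nonneg _)).2 fun j => norm_le_pi_norm y _
  have h1 : ∀ j, fderiv ℝ (jointLower H) (0 : Fin m ⊕ (Fin n ⊕ Fin n) → ℝ)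
      (Pi.single (Sum.inr j) 1) = 0 := fun j => by
    rw [(hO2.hasFDerivAt one_lt_two).fderiv]; rfl
  obtain ⟨p, -, hp⟩ := exists_phaseTaylor k r hr hc h0 h1 fun h j => by
    have hpar : Tendsto (fun y : Fin m ⊕ (Fin n ⊕ Fin n) → ℝ => fun i => y (Sum.inl i))
        (𝓝 0) (𝓝 0) :=
      (show Continuous fun y : Fin m ⊕ (Fin n ⊕ Fin n) → ℝ => fun i => y (Sum.inl i) by
        fun_prop).tendsto 0
    filter_upwards [hray.eventually hc.eventually_differentiableAt,
      hpar.eventually (heq h)] with y hy1 hy2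
    rw [rayPt_phaseVars_zero] at hy1 ⊢
    rw [fderiv_jointLower hy1]
    rcases j with i | i
    · have := congrFun hy2 (Sum.inr i)
      simpa [hamVF] using this
    · exact congrFun hy2 (Sum.inl i)
  exact ⟨p, hp⟩

/-- The pulled-back phase variables have no constant term, and for r = 2 every monomial in them
contains some z_j. They are thus O(|(ε, z)|), respectively O(|z|), and the Taylor remainder keeps
its size under substitution. -/
theorem isBigO_comp_elim {r k : ℕ} (hr : r = 1 ∨ r = 2)
    {Φ Ψ : Param m → Phase (n + 1) → Phase (n + 1)}
    {θ : MvPolynomial (Fin m ⊕ (Fin n ⊕ Fin n)) ℝ →ₐ[ℝ] MvPolynomial (Fin m ⊕ (Fin n ⊕ Fin n)) ℝ}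
    (h : PolyChange r Φ Ψ θ) {R : (Fin m ⊕ (Fin n ⊕ Fin n) → ℝ) → ℝ}
    (hR : R =O[𝓝 0] fun y => ‖fun j => y (Sum.inr j)‖ ^ r * ‖y‖ ^ (k + 2 - r)) :
    ((fun y : Param m × Phase n =>
        R (Sum.elim y.1 fun j => eval (Sum.elim y.1 y.2) (θ (X (Sum.inr j))))) =O[𝓝 0]
      fun y => ‖y‖ ^ (k + 2)) ∧
    (r = 2 → (fun y : Param m × Phase n =>
        R (Sum.elim y.1 fun j => eval (Sum.elim y.1 y.2) (θ (X (Sum.inr j))))) =O[𝓝 0]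
      fun y => ‖y.2‖ ^ 2 * ‖y‖ ^ k) := by
  set ψ : Param m × Phase n → Phase n :=
    fun y j => eval (Sum.elim y.1 y.2) (θ (X (Sum.inr j))) with hψ
  have h1 : ψ =O[𝓝 0] fun y => ‖y‖ := by
    refine isBigO_pi.2 fun j => ?_
    have hX := h.raises_one.map_mem (X_mem_filtration (fun _ => 1) (Sum.inr j))
    simpa using isBigO_eval (i := 0) (j := 1) (mem_filtration_zero _ _) hX
  have h2 : r = 2 → ψ =O[𝓝 0] fun y => ‖y.2‖ := fun hr2 => by
    refine isBigO_pi.2 fun j => ?_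
    have hX := h.raises_one.map_mem (X_mem_filtration (fun _ => 1) (Sum.inr j))
    have hX' := (h.raises_phase hr2).map_mem (X_mem_filtration phaseWeight (Sum.inr j))
    simpa using isBigO_eval (i := 1) (j := 0) hX' hX
  have h3 : (fun y : Param m × Phase n => (Sum.elim y.1 (ψ y) : _ → ℝ)) =O[𝓝 0]
      fun y => ‖y‖ := by
    refine isBigO_pi.2 ?_
    rintro (i | j)
    · exact IsBigO.of_norm_le fun y => (norm_le_pi_norm y.1 i).trans (norm_fst_le y)
    · exact isBigO_pi.1 h1 j
  have ht : Tendsto (fun y : Param m × Phase n => (Sum.elim y.1 (ψ y) : _ → ℝ)) (𝓝 0) (𝓝 0) :=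
    h3.trans_tendsto tendsto_norm_zero
  have h4 := hR.comp_tendsto ht
  refine ⟨h4.trans ?_, fun hr2 => h4.trans ?_⟩
  · have h5 := (h1.norm_left.pow r).mul (h3.norm_left.pow (k + 2 - r))
    refine h5.congr_right fun y => ?_
    rw [← pow_add]
    congr 1
    omega
  · subst hr2
    exact ((h2 rfl).norm_left.pow 2).mul (h3.norm_left.pow k)

theorem totalDegree_le_of_mem {τ : Type*} {N : MvPolynomial τ ℝ} {k : ℕ}
    (hN : N ∈ restrictSupport ℝ {s | Finsupp.weight (fun _ => 1) s < k + 2}) :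
    N.totalDegree ≤ k + 1 := by
  refine Finset.sup_le fun s hs => ?_
  have := hN hs
  rw [Set.mem_ofPred_eq, Finsupp.weight_apply] at this
  simp only [smul_eq_mul, mul_one] at this
  omega

theorem quadraticPart_isBigO (K : Phase n → ℝ) :
    quadraticPart K =O[𝓝 0] fun z => ‖z‖ ^ 2 := by
  refine IsBigO.of_bound (1 / 2 * ‖fderiv ℝ (fderiv ℝ K) 0‖) (Eventually.of_forall fun z => ?_)
  rw [quadraticPart, norm_mul, norm_pow, norm_norm, mul_assoc, pow_two, ← mul_assoc ‖_‖ ‖z‖ ‖z‖]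
  rw [Real.norm_of_nonneg (by norm_num : (0 : ℝ) ≤ 1 / 2)]
  gcongr
  exact (fderiv ℝ (fderiv ℝ K) 0).le_opNorm₂ z z

/-- Degree at most 1 means weight at most 2. This settles k = 0, where the normal form has no higher
terms. -/
theorem eq_zero_of_mem {N : MvPolynomial (Fin m ⊕ (Fin n ⊕ Fin n)) ℝ}
    (h1 : N ∈ restrictSupport ℝ {s | Finsupp.weight (fun _ => 1) s < 2})
    (h2 : N ∈ filtration parWeight 3) : N = 0 := by
  by_contra hne
  obtain ⟨s, hs⟩ := support_nonempty.2 hne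
  have h3 := h1 hs
  have h4 := h2 hs
  rw [Set.mem_ofPred_eq, oneWeight_eq] at h3
  rw [Set.mem_ofPred_eq, parWeight_eq] at h4
  omega

theorem isBigO_quadForm (B : Matrix (Fin n ⊕ Fin n) (Fin n ⊕ Fin n) ℝ) :
    (fun z : Phase n => (1 / 2) * (z ⬝ᵥ B *ᵥ z)) =O[𝓝 0] fun z => ‖z‖ ^ 2 := by
  have h1 : quadForm (m := 0) B ∈ filtration (fun _ => 1) (2 + 0) := fun s hs => by
    have := quadForm_mem_phase B hs
    rw [Set.mem_ofPred_eq, phaseWeight_eq] at this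
    rw [Set.mem_ofPred_eq, oneWeight_eq]
    omega
  have h2 := isBigO_eval (quadForm_mem_phase B) h1
  have ht : Tendsto (fun z : Phase n => ((0 : Param 0), z)) (𝓝 0) (𝓝 0) :=
    (show Continuous fun z : Phase n => ((0 : Param 0), z) by fun_prop).tendsto 0
  simpa [Function.comp_def, eval_quadForm] using h2.comp_tendsto ht

end Assembly

end HamNF

/-! ### The normal form theorem. -/

open HamNF in
/-- Existence of the normalising change of variables; the case `r = 2` is that of an equilibrium
at `(q, p) = 0` for all small parameters. -/
theorem HamNF.exists_normalForm (m n k r : ℕ) (hr : r = 1 ∨ r = 2)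
    (H : Param m → Phase (n + 1) → ℝ)
    (hsmooth : ContDiffAt ℝ ((k + 2 : ℕ) : WithTop ℕ∞) (Function.uncurry H) 0)
    (hH : (fun y : Param m × Phase (n + 1) => H y.1 y.2) =O[𝓝 0]
      fun y => ‖(y.1, dropP0 y.2)‖ * ‖dropP0 y.2‖)
    (heq : r = 2 → ∀ᶠ ε : Param m in 𝓝 0, hamVF (lowerOrder H ε) 0 = 0) :
    ∃ (Φ Ψ : Param m → Phase (n + 1) → Phase (n + 1))
      (θ : MvPolynomial (Fin m ⊕ (Fin n ⊕ Fin n)) ℝ →ₐ[ℝ]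
        MvPolynomial (Fin m ⊕ (Fin n ⊕ Fin n)) ℝ)
      (P : MvPolynomial (Fin m ⊕ (Fin n ⊕ Fin n)) ℝ), PolyChange r Φ Ψ θ ∧
      InNormalForm k (lowerOrder fun ε X => H ε (Ψ ε X)) P ∧
      (r = 2 → ((fun y : Param m × Phase n => evalAt P y.1 y.2) =O[𝓝 0]
          (fun y => ‖y.2‖ ^ 2 * ‖y‖)) ∧
        ((fun y : Param m × Phase n => lowerOrder (fun ε X => H ε (Ψ ε X)) y.1 y.2
              - quadraticPart (lowerOrder (fun ε X => H ε (Ψ ε X)) 0) y.2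
              - evalAt P y.1 y.2) =O[𝓝 0] (fun y => ‖y.2‖ ^ 2 * ‖y‖ ^ k))) := by
  obtain ⟨p, hp2, hpr, hR⟩ := exists_taylor_lowerOrder hr hsmooth hH heq
  obtain ⟨B, hB, hpB⟩ := exists_quadForm hp2 (filtration_anti (by omega) hpr)
  obtain ⟨Φ, Ψ, θ, N, hθ, hNk, hN3, hNL, hrem, hsharp⟩ :=
    exists_polynomial_normalForm hB hr hpB (fun h => h ▸ hpr) k
  set K := lowerOrder fun ε X => H ε (Ψ ε X) with hK
  -- The error is the Taylor remainder composed with the change of variables plus the polynomial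
  -- remainder of normalisation.
  have hKR : ∀ ε z, K ε z - (1 / 2) * (z ⬝ᵥ B *ᵥ z) - evalAt N ε z =
      (jointLower H (Sum.elim ε fun j => MvPolynomial.eval (Sum.elim ε z)
          (θ (MvPolynomial.X (Sum.inr j)))) -
        MvPolynomial.eval (Sum.elim ε fun j => MvPolynomial.eval (Sum.elim ε z)
          (θ (MvPolynomial.X (Sum.inr j)))) p) +
      MvPolynomial.eval (Sum.elim ε z) (θ p - quadForm B - N) := fun ε z => by
    rw [map_sub, map_sub, hθ.eval_pullback, eval_quadForm, evalAt]
    have : K ε z = jointLower H (Sum.elim ε fun j => MvPolynomial.eval (Sum.elim ε z)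
        (θ (MvPolynomial.X (Sum.inr j)))) := congrArg (H ε) (hθ.pullback ε z)
    rw [this]
    ring
  obtain ⟨hR1, hR2⟩ := isBigO_comp_elim hr hθ hR
  have hE1 : (fun y : Param m × Phase n => K y.1 y.2 - (1 / 2) * (y.2 ⬝ᵥ B *ᵥ y.2) -
      evalAt N y.1 y.2) =O[𝓝 0] fun y => ‖y‖ ^ (k + 2) := by
    have h1 := isBigO_eval (i := 0) (j := k + 2) (mem_filtration_zero _ _)
      (by simpa using hrem)
    simp only [pow_zero, one_mul] at h1
    exact (hR1.add h1).congr_left fun y => (hKR y.1 y.2).symm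
  have hE2 : r = 2 → (fun y : Param m × Phase n => K y.1 y.2 - (1 / 2) * (y.2 ⬝ᵥ B *ᵥ y.2) -
      evalAt N y.1 y.2) =O[𝓝 0] fun y => ‖y.2‖ ^ 2 * ‖y‖ ^ k := fun h => by
    have h1 := isBigO_eval (i := 2) (j := k) (hsharp h).2 (by rwa [add_comm 2 k])
    exact ((hR2 h).add h1).congr_left fun y => (hKR y.1 y.2).symm
  have hN0 := isBigO_eval_par_zero hN3
  have hKc : ContDiffAt ℝ ((k + 2 : ℕ) : WithTop ℕ∞) (K 0) 0 := by
    have h1 : ContDiff ℝ ∞ fun z : Phase n => ((0 : Param m), Ψ 0 (extend z)) :=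
      contDiff_const.prodMk (hθ.smooth_inv.comp (contDiff_const.prodMk contDiff_extend))
    have h2 : ContDiffAt ℝ ((k + 2 : ℕ) : WithTop ℕ∞) (Function.uncurry H)
        ((0 : Param m), Ψ 0 (extend (0 : Phase n))) := by
      rw [extend_zero, hθ.map_zero_inv]; exact hsmooth
    have h3 : ContDiffAt ℝ ((k + 2 : ℕ) : WithTop ℕ∞)
        (fun z : Phase n => ((0 : Param m), Ψ 0 (extend z))) 0 :=
      h1.contDiffAt.of_le (by generalize k + 2 = l; exact_mod_cast le_top)
    exact ContDiffAt.comp (g := Function.uncurry H)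
      (f := fun z : Phase n => ((0 : Param m), Ψ 0 (extend z))) 0 h2 h3
  have hKc2 : ContDiffAt ℝ 2 (K 0) 0 := hKc.of_le (by norm_cast; omega)
  -- For k ≥ 1 the error at ε = 0 is of third order and so determines the Hessian; for k = 0 the
  -- form B need not be the quadratic part.
  have hess : k ≠ 0 → ∀ z, fderiv ℝ (fderiv ℝ (K 0)) 0 z z = z ⬝ᵥ B *ᵥ z := fun hk z => by
    have ht : Tendsto (fun z : Phase n => ((0 : Param m), z)) (𝓝 0) (𝓝 0) :=
      (show Continuous fun z : Phase n => ((0 : Param m), z) by fun_prop).tendsto 0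
    have h1 : (fun z : Phase n => K 0 z - (1 / 2) * (z ⬝ᵥ B *ᵥ z) - evalAt N 0 z) =O[𝓝 0]
        fun z => ‖z‖ ^ (k + 2) := by
      simpa [Function.comp_def] using hE1.comp_tendsto ht
    have h2 : (fun z : Phase n => ‖z‖ ^ (k + 2)) =O[𝓝 0] fun z => ‖z‖ ^ 3 :=
      IsBigO.of_bound 1 <| by
        filter_upwards [Metric.ball_mem_nhds (0 : Phase n) one_pos] with z hz
        rw [mem_ball_zero_iff] at hz
        rw [norm_pow, norm_pow, norm_norm, one_mul]
        exact pow_le_pow_of_le_one (norm_nonneg _) hz.le (by omega)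
    have h3 : (fun z : Phase n => K 0 z - (1 / 2) * (z ⬝ᵥ B *ᵥ z)) =O[𝓝 0] fun z => ‖z‖ ^ 3 := by
      refine ((h1.trans h2).add hN0).congr_left fun z => ?_
      rw [evalAt]; ring
    rw [hessian_of_isBigO hKc2 (fun t z => ?_) (isBigO_quadForm B) h3 z]
    · ring
    · simp only [Matrix.mulVec_smul, dotProduct_smul, smul_dotProduct, smul_eq_mul]
      ring
  have hquad : (fun y : Param m × Phase n =>
      (1 / 2) * (y.2 ⬝ᵥ B *ᵥ y.2) - quadraticPart (K 0) y.2) =O[𝓝 0]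
        fun y => ‖y.2‖ ^ 2 * ‖y‖ ^ k := by
    -- For k = 0 both quadratic forms are O(|z|²), which is the size of the remainder allowed.
    rcases Nat.eq_zero_or_pos k with rfl | hk
    · have h1 := (isBigO_quadForm B).sub (quadraticPart_isBigO (K 0))
      simpa [Function.comp_def] using
        h1.comp_tendsto (continuous_snd.tendsto (0 : Param m × Phase n))
    · refine (isBigO_zero _ _).congr_left fun y => ?_
      rw [quadraticPart, hess hk.ne', sub_self]
  have hle : (fun y : Param m × Phase n => ‖y.2‖ ^ 2 * ‖y‖ ^ k) =O[𝓝 0] fun y => ‖y‖ ^ (k + 2) := by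
    refine IsBigO.of_norm_le fun y => ?_
    rw [norm_mul, norm_pow, norm_pow, norm_norm, norm_norm, add_comm k 2, pow_add]
    have := norm_snd_le y
    gcongr
  have hN1 : ∀ s ∈ N.support, 3 ≤ 2 * ∑ i, s (Sum.inl i) + ∑ j, s (Sum.inr j) := fun s hs => by
    have := hN3 hs
    rwa [Set.mem_ofPred_eq, parWeight_eq] at this
  refine ⟨Φ, Ψ, θ, N, hθ, ⟨totalDegree_le_of_mem hNk, ?_, ?_, hN0, ?_⟩, fun h => ⟨?_, ?_⟩⟩
  · rcases Nat.eq_zero_or_pos k with rfl | hk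
    · rw [eq_zero_of_mem hNk hN3]
      exact elphickInvariant_of_linVF (map_zero _)
    · rw [linearisation_eq_hamMat hB hKc2 (hess hk.ne')]
      exact elphickInvariant_of_linVF hNL
  · have h1 := isBigO_eval (i := 0) (j := 2) (p := N) (mem_filtration_zero _ _) fun s hs => by
      have := hN1 s hs
      rw [Set.mem_ofPred_eq, oneWeight_eq]
      omega
    simpa [evalAt] using h1
  · refine (hE1.add (hquad.trans hle)).congr_left fun y => ?_
    ring
  · have h1 := isBigO_eval (i := 2) (j := 1) (p := N) (hsharp h).1 fun s hs => by
      have h2 := hN1 s hs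
      have h3 := (hsharp h).1 hs
      rw [Set.mem_ofPred_eq, phaseWeight_eq] at h3
      rw [Set.mem_ofPred_eq, oneWeight_eq]
      omega
    simpa [evalAt] using h1
  · refine ((hE2 h).add hquad).congr_left fun y => ?_
    ring

theorem mainTheorem4 (m n k : ℕ) (H : HamNF.Param m → HamNF.Phase (n + 1) → ℝ)
    (hsmooth : ContDiffAt ℝ ((k + 2 : ℕ) : WithTop ℕ∞) (Function.uncurry H) 0)
    (hcyclic : HamNF.IsCyclicP0 H)
    (hH : (fun y : HamNF.Param m × HamNF.Phase (n + 1) => H y.1 y.2) =O[𝓝 0]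
      (fun y => ‖(y.1, HamNF.dropP0 y.2)‖ * ‖HamNF.dropP0 y.2‖)) :
    ∃ (Φ Ψ : HamNF.Param m → HamNF.Phase (n + 1) → HamNF.Phase (n + 1))
      (P : MvPolynomial (Fin m ⊕ (Fin n ⊕ Fin n)) ℝ),
      HamNF.IsCanonicalChange Φ Ψ ∧
      HamNF.IsNearIdentity Φ ∧
      -- `Q_0 = q_0`
      (∀ᶠ y : HamNF.Param m × HamNF.Phase (n + 1) in 𝓝 0,
        Φ y.1 y.2 (Sum.inl 0) = y.2 (Sum.inl 0)) ∧
      -- `P_0` is cyclic for the transformed Hamiltonian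
      HamNF.IsCyclicP0 (fun ε X => H ε (Ψ ε X)) ∧
      -- the transformed lower-order system is in normal form
      HamNF.InNormalForm k (HamNF.lowerOrder fun ε X => H ε (Ψ ε X)) P ∧
      -- sharper estimates if the origin is an equilibrium of the lower-order system for small `ε`
      ((∀ᶠ ε : HamNF.Param m in 𝓝 0, HamNF.hamVF (HamNF.lowerOrder H ε) 0 = 0) →
        ((fun y : HamNF.Param m × HamNF.Phase (n + 1) => Φ y.1 y.2 - y.2) =O[𝓝 0]
          (fun y => ‖(y.1, HamNF.dropP0 y.2)‖ * ‖HamNF.restrict y.2‖)) ∧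
        ((fun y : HamNF.Param m × HamNF.Phase n => HamNF.evalAt P y.1 y.2) =O[𝓝 0]
          (fun y => ‖y.2‖ ^ 2 * ‖y‖)) ∧
        ((fun y : HamNF.Param m × HamNF.Phase n =>
            HamNF.lowerOrder (fun ε X => H ε (Ψ ε X)) y.1 y.2
              - HamNF.quadraticPart (HamNF.lowerOrder (fun ε X => H ε (Ψ ε X)) 0) y.2
              - HamNF.evalAt P y.1 y.2) =O[𝓝 0]
          (fun y => ‖y.2‖ ^ 2 * ‖y‖ ^ k))) := by

  -- The order r is fixed beforehand by whether the equilibrium hypothesis holds, so that one change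
  -- of variables serves both the general and the sharper claims.
  obtain ⟨r, hr, heq, heq'⟩ : ∃ r : ℕ, (r = 1 ∨ r = 2) ∧
      (r = 2 → ∀ᶠ ε : HamNF.Param m in 𝓝 0, HamNF.hamVF (HamNF.lowerOrder H ε) 0 = 0) ∧
      ((∀ᶠ ε : HamNF.Param m in 𝓝 0, HamNF.hamVF (HamNF.lowerOrder H ε) 0 = 0) → r = 2) := by
    by_cases h : ∀ᶠ ε : HamNF.Param m in 𝓝 0, HamNF.hamVF (HamNF.lowerOrder H ε) 0 = 0
    · exact ⟨2, Or.inr rfl, fun _ => h, fun _ => rfl⟩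
    · exact ⟨1, Or.inl rfl, fun h' => by omega, fun h' => absurd h' h⟩
  obtain ⟨Φ, Ψ, θ, P, hθ, hnf, hsharp⟩ := HamNF.exists_normalForm m n k r hr H hsmooth hH heq
  exact ⟨Φ, Ψ, P, hθ.isCanonicalChange, ⟨hθ.map_zero, hθ.hasFDerivAt_zero.fderiv⟩,
    Eventually.of_forall fun y => hθ.q0 _ _,
    hθ.isCyclicP0 hcyclic hsmooth.eventually_differentiableAt, hnf,
    fun h => ⟨hθ.sub_isBigO (heq' h), hsharp (heq' h)⟩⟩
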